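/- Let $m\ge 1$ and $0\le a\le m-1$ be integers. Write $(q)_n=\prod_{i=1}^n(1-q^i)$, and let $\begin{bmatrix} n\\ c\end{bmatrix}=\frac{(q)_n}{(q)_c(q)_{n-c}}$ for $0\le c\le n$ and $0$ otherwise (a polynomial in $q$). Consider the formal series $$X_m^{(a)}(q)=\sum_{k_1,\dots,k_m=0}^\infty (q)_{k_m}\,q^{k_1^2+\cdots+k_{m-1}^2+k_{a+1}+\cdots+k_{m-1}}\left(\prod_{\substack{1\le i\le m-1\\ i\ne a}}\begin{bmatrix}k_{i+1}\\ k_i\end{bmatrix}\right)\begin{bmatrix}k_{a+1}+1\\ k_a\end{bmatrix},$$ where $k_0=0$ (so that the last factor is $1$ if $a=0$). Let $\chi=\chi_{8m+4}^{(a)}$ be the function on $\mathbb{Z}$ of period $8m+4$ with $\chi(n)=1$ for $n\equiv 2m-2a-1$ and $n\equiv 6m+2a+5$, $\chi(n)=-1$ for $n\equiv 2m+2a+3$ and $n\equiv 6m-2a+1$ modulo $8m+4$, and $\chi(n)=0$ otherwise. Let $L(s,\chi)$ be the analytic continuation to $\mathbb{C}$ of $\sum_{n\ge1}\chi(n)n^{-s}$,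 and put $$T_m^{(a)}(n)=\tfrac12(-1)^{n+1}L(-2n-1,\chi)\qquad(n\ge 0).$$ Then the following hold. (i) On substituting $q=e^{-t}$ and expanding each summand as a power series in $t$, only finitely many $(k_1,\dots,k_m)$ contribute to each power of $t$, and in the ring of formal power series in $t$ $$X_m^{(a)}(e^{-t})=e^{\frac{(2m-2a-1)^2}{8(2m+1)}t}\sum_{n=0}^\infty\frac{T_m^{(a)}(n)}{n!}\left(\frac{t}{8(2m+1)}\right)^n .$$ (ii) For all $n\ge0$, with $B_k(x)$ the Bernoulli polynomials, $$T_m^{(a)}(n)=(-1)^n\,2^{4n}\,\frac{(2m+1)^{2n+1}}{n+1}\sum_{r=1}^{8m+4}\chi(r)\,B_{2n+2}\!\left(\frac{r}{8m+4}\right).$$ (iii) The series $F(q)=-\frac12\sum_{n=0}^\infty n\,\chi(n)\,q^{\frac{n^2-(2m-2a-1)^2}{8(2m+1)}}$ converges for $0<q<1$, and $F(e^{-t})$ has, as $t\searrow0$, the asymptotic expansion given by the formal power series $X_m^{(a)}(e^{-t})$: if $X_m^{(a)}(e^{-t})=\sum_j c_jt^j$, then $F(e^{-t})-\sum_{j<N}c_jt^j=O(t^N)$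 for every $N\ge 0$. -/

import Mathlib

open scoped PowerSeries Asymptotics

noncomputable section

/-- The `q`-shifted factorial `(x)_n = (x; q)_n = ∏_{i=1}^{n} (1 - x q^{i-1})`. -/
def qPoch {R : Type*} [CommRing R] (x q : R) (n : ℕ) : R :=
  ∏ i ∈ Finset.range n, (1 - x * q ^ i)

/-- The `q`-binomial coefficient `[n, c]`, evaluated at an element `q` of any commutative ring.
It is a polynomial in `q`, given here by its Pascal rule so that it also makes sense where
`(q)_c (q)_{n-c}` is not invertible; `qBinom_mul` and `qBinom_eq_zero` below show that it is
`(q)_n / ((q)_c (q)_{n-c})` for `0 ≤ c ≤ n` and `0` for `c > n`. -/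
def qBinom {R : Type*} [CommRing R] (q : R) : ℕ → ℕ → R
  | _, 0 => 1
  | 0, _ + 1 => 0
  | n + 1, c + 1 => q ^ (c + 1) * qBinom q n (c + 1) + qBinom q n c

theorem qBinom_eq_zero {R : Type*} [CommRing R] (q : R) :
    ∀ n c : ℕ, n < c → qBinom q n c = 0
  | 0, 0, h => absurd h (lt_irrefl 0)
  | _ + 1, 0, h => absurd h (Nat.not_lt_zero _)
  | 0, _ + 1, _ => by simp [qBinom]
  | n + 1, c + 1, h => by
      rw [qBinom, qBinom_eq_zero q n (c + 1) (by omega), qBinom_eq_zero q n c (by omega)]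
      simp

theorem qPoch_self_succ {R : Type*} [CommRing R] (q : R) (n : ℕ) :
    qPoch q q (n + 1) = qPoch q q n * (1 - q ^ (n + 1)) := by
  rw [qPoch, qPoch, Finset.prod_range_succ, pow_succ']

theorem qBinom_self {R : Type*} [CommRing R] (q : R) (n : ℕ) : qBinom q n n = 1 := by
  induction n with
  | zero => simp [qBinom]
  | succ n ih => rw [qBinom, qBinom_eq_zero q n (n + 1) (by omega), ih]; simp

theorem qBinom_mul {R : Type*} [CommRing R] (q : R) (n : ℕ) :
    ∀ c : ℕ, c ≤ n → qBinom q n c * (qPoch q q c * qPoch q q (n - c)) = qPoch q q n := by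
  induction n with
  | zero =>
    intro c hc
    obtain rfl : c = 0 := by omega
    simp [qBinom, qPoch]
  | succ n ih =>
    intro c hc
    rcases c with _ | c
    · simp [qBinom, qPoch]
    rcases Nat.lt_or_ge c n with h | h
    · obtain ⟨d, rfl⟩ : ∃ d, n = c + d + 1 := ⟨n - c - 1, by omega⟩
      have h1 := ih (c + 1) (by omega)
      have h2 := ih c (by omega)
      rw [show c + d + 1 - (c + 1) = d by omega] at h1
      rw [show c + d + 1 - c = d + 1 by omega] at h2
      rw [show c + d + 1 + 1 - (c + 1) = d + 1 by omega, qBinom, qPoch_self_succ q (c + d + 1)]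
      have h3 := qPoch_self_succ q c
      have h4 := qPoch_self_succ q d
      calc _ = q ^ (c + 1) * (1 - q ^ (d + 1)) *
              (qBinom q (c + d + 1) (c + 1) * (qPoch q q (c + 1) * qPoch q q d)) +
              (1 - q ^ (c + 1)) *
              (qBinom q (c + d + 1) c * (qPoch q q c * qPoch q q (d + 1))) := by
            rw [h3, h4]; ring
        _ = _ := by rw [h1, h2]; ring
    · obtain rfl : c = n := by omega
      rw [qBinom_self]
      simp [qPoch]

/-- The tuple `(k_1, …, k_m)` read with indices starting at `1`; in addition `k_0 = 0`. -/
def kIdx {m : ℕ} (k : Fin m → ℕ) (i : ℕ) : ℕ :=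
  if h : 1 ≤ i ∧ i ≤ m then k ⟨i - 1, by omega⟩ else 0

/-- The summand of index `k = (k_1, …, k_m)` of the `q`-series `X_m^{(a)}(q)`. For `a = 0` the last
factor is `[k_1 + 1, k_0] = [k_1 + 1, 0] = 1`. -/
def XTerm {R : Type*} [CommRing R] (m a : ℕ) (q : R) (k : Fin m → ℕ) : R :=
  qPoch q q (kIdx k m) *
    q ^ (∑ i ∈ Finset.Ico 1 m, kIdx k i ^ 2 + ∑ i ∈ Finset.Ico (a + 1) m, kIdx k i) *
    (∏ i ∈ (Finset.Ico 1 m).erase a, qBinom q (kIdx k (i + 1)) (kIdx k i)) *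
    qBinom q (kIdx k (a + 1) + 1) (kIdx k a)

/-- The formal power series `e^{c t}` in the variable `t`. -/
def expSeries (c : ℂ) : ℂ⟦X⟧ := PowerSeries.rescale c (PowerSeries.exp ℂ)

/-- The Taylor expansion `X_m^{(a)}(e^{-t})`, a formal power series in `t`: the sum over all `k` of
the Taylor expansions at `q = e^{-t}` of the summands, formed coefficientwise. -/
def XSeries (m a : ℕ) : ℂ⟦X⟧ :=
  PowerSeries.mk fun j =>
    ∑ᶠ k : Fin m → ℕ, PowerSeries.coeff j (XTerm m a (expSeries (-1)) k)

/-- The periodic function `χ_{8m+4}^{(a)}`. -/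
def chi (m a : ℕ) (n : ZMod (8 * m + 4)) : ℤ :=
  if n = 2 * m - 2 * a - 1 then 1
  else if n = 2 * m + 2 * a + 3 then -1
  else if n = 6 * m - 2 * a + 1 then -1
  else if n = 6 * m + 2 * a + 5 then 1
  else 0

/-- `T_m^{(a)}(n) = ½ (-1)^{n+1} L(-2n-1, χ_{8m+4}^{(a)})`, where `L(s, χ)` is the analytic
continuation of `∑_{n ≥ 1} χ(n) n^{-s}`. -/
def TNumber (m a n : ℕ) : ℂ :=
  1 / 2 * (-1) ^ (n + 1) *
    ZMod.LFunction (fun r : ZMod (8 * m + 4) => (chi m a r : ℂ)) (-2 * n - 1)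

/-- The `n`-th term `n χ(n) q^{(n² - (2m-2a-1)²) / (8(2m+1))}` for real `q > 0`. -/
def halfTerm (m a : ℕ) (q : ℝ) (n : ℕ) : ℝ :=
  n * chi m a n *
    q ^ (((n : ℝ) ^ 2 - (2 * m - 2 * a - 1 : ℝ) ^ 2) / (8 * (2 * m + 1)))

/-- The half-derivative `-½ ∑_{n ≥ 0} n χ(n) q^{(n² - (2m-2a-1)²) / (8(2m+1))}`. -/
def halfDerivative (m a : ℕ) (q : ℝ) : ℝ := -(1 / 2) * ∑' n : ℕ, halfTerm m a q n

end

/-! The multisum is deformed by a variable `x`. With `c_n(x)` the sequence `innerSum m (a + 1) q x`,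
the series is `∑ (q)_n c_n(1)` (`coeff_XSeries`), and the deformation is the identity `∑ (x)_{n+1}
x^n c_n(x) = ∑ thetaTerm`. At `x = q^{-N}` both sides are finite, and `sum_qPoch_mul_innerSum`
proves the identity there: `c_n` is an iterate of Bailey steps, which `baileyEigen` diagonalises,
and the outer sum over `n` is a q-Vandermonde sum.

Now put `q = e^{-t}`, `x = e^{zt}`. The theta side satisfies a first-order recursion under `z ↦ z -
1`. Replacing formal sums `∑ χ(n) n^p` by the numbers `L(-p, χ)` gives `thetaSeries`, which
satisfies the same recursion because `χ` changes sign under translation by `4m + 2`, and which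
vanishes at `z = 0` because `L(-2i, χ) = 0`. Hence the two agree for every natural `z`. Each
coefficient of `t^j` is a polynomial in `z`, so they agree identically (`coeff_truncSum_formal`).
Since `(x)_{n+1}` contains the factor `1 - x`, the part linear in `z` is `-t` times the original
series on one side and is made of the numbers `L(-2n-1, χ)` on the other. Dividing by `-t` gives
(i).

Part (ii) is the value of the Hurwitz zeta function at negative integers.

For (iii), the exponential prefactor splits off and leaves `∑ χ(n) n e^{-s n²}` with `s = t /
(8(2m+1))`, an alternating series over blocks of length `4m + 2`. Its Euler transform to order `K`
has a finite part that, on polynomials of degree less than `K`, returns the L-values exactly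
(`eulerSum_polynomial`), so Taylor expansion in `s` is harmless there. The remainder consists of
`K`-th differences of a function of `√s n`, hence is small of high order
(`isBigO_tsum_chi_gaussTerm`). Multiplying by the prefactor and comparing with (i) finishes the
proof. -/

/-! ### q-binomial sums, Bailey steps and their eigenvectors -/

section QSeries

open Finset

section Ring

variable {R : Type*} [CommRing R]

@[simp] theorem qPoch_zero (x q : R) : qPoch x q 0 = 1 := by simp [qPoch]

theorem qPoch_succ (x q : R) (n : ℕ) : qPoch x q (n + 1) = qPoch x q n * (1 - x * q ^ n) := by
  rw [qPoch, qPoch, prod_range_succ]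

theorem qPoch_add (x q : R) (a b : ℕ) :
    qPoch x q (a + b) = qPoch x q a * qPoch (x * q ^ a) q b := by
  induction b with
  | zero => simp
  | succ b ih => rw [← add_assoc, qPoch_succ, qPoch_succ, ih, pow_add]; ring

theorem qPoch_succ' (x q : R) (n : ℕ) : qPoch x q (n + 1) = (1 - x) * qPoch (x * q) q n := by
  rw [add_comm, qPoch_add]; simp [qPoch_succ]

@[simp] theorem qBinom_zero_right (q : R) (n : ℕ) : qBinom q n 0 = 1 := by cases n <;> rw [qBinom]

theorem qBinom_succ_succ (q : R) (n c : ℕ) :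
    qBinom q (n + 1) (c + 1) = q ^ (c + 1) * qBinom q n (c + 1) + qBinom q n c := by rw [qBinom]

theorem qBinom_absorb (q : R) (n c : ℕ) (h : c ≤ n) :
    (1 - q ^ (c + 1)) * qBinom q n (c + 1) = (1 - q ^ (n - c)) * qBinom q n c := by
  induction n generalizing c with
  | zero => obtain rfl : c = 0 := by omega
            simp [qBinom]
  | succ n ih =>
    rcases c with _ | c
    · have := ih 0 (by omega)
      simp only [qBinom_succ_succ, qBinom_zero_right, Nat.sub_zero, zero_add] at this ⊢
      linear_combination (q : R) * this
    rcases Nat.eq_or_lt_of_le h with h' | h'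
    · obtain rfl : c = n := by omega
      rw [qBinom_eq_zero _ _ _ (by omega)]; simp
    · obtain ⟨d, rfl⟩ : ∃ d, n = c + d + 1 := ⟨n - c - 1, by omega⟩
      have h1 := ih (c + 1) (by omega)
      have h2 := ih c (by omega)
      rw [show c + d + 1 - (c + 1) = d by omega] at h1
      rw [show c + d + 1 - c = d + 1 by omega] at h2
      rw [show c + d + 1 + 1 - (c + 1) = d + 1 by omega, qBinom_succ_succ q _ c,
        qBinom_succ_succ q _ (c + 1)]
      linear_combination q ^ (c + 1 + 1) * h1 + h2

theorem qBinom_succ_succ' (q : R) (n c : ℕ) (h : c ≤ n) :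
    qBinom q (n + 1) (c + 1) = qBinom q n (c + 1) + q ^ (n - c) * qBinom q n c := by
  rw [qBinom_succ_succ]
  linear_combination - qBinom_absorb q n c h

/-- Pascal's rule under the summation sign. It drives both q-Vandermonde inductions: the two terms
on the right recombine into one term of the shorter sum with a shifted parameter. -/
theorem sum_qBinom_succ (q : R) (s : ℕ) (f : ℕ → R) :
    ∑ i ∈ range (s + 2), qBinom q (s + 1) i * f i =
      ∑ i ∈ range (s + 1), qBinom q s i * (q ^ i * f i + f (i + 1)) := by
  rw [sum_range_succ']
  simp only [qBinom_succ_succ, add_mul, sum_add_distrib, mul_add]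
  have h := sum_range_succ' (fun i => qBinom q s i * (q ^ i * f i)) (s + 1)
  rw [sum_range_succ, qBinom_eq_zero q s (s + 1) (by omega)] at h
  simp only [zero_mul, add_zero, pow_zero, qBinom_zero_right, one_mul] at h
  rw [h, qBinom_zero_right]
  simp only [mul_assoc, mul_left_comm (q ^ _)]
  ring

/-- The `q`-Vandermonde sum in the limit in which one of its parameters goes to infinity. -/
theorem sum_qBinom_mul_qPoch (q Y : R) (s : ℕ) :
    ∑ i ∈ range (s + 1), qBinom q s i * (Y ^ i * q ^ i ^ 2 * qPoch (Y * q ^ (i + 1)) q (s - i)) =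
      1 := by
  induction s generalizing Y with
  | zero => simp
  | succ s ih =>
    rw [sum_qBinom_succ, ← ih (Y * q)]
    refine sum_congr rfl fun i hi => ?_
    obtain ⟨d, rfl⟩ : ∃ d, s = i + d := ⟨s - i, by have := mem_range.1 hi; omega⟩
    rw [show i + d + 1 - i = d + 1 by omega, show i + d + 1 - (i + 1) = d by omega,
      show i + d - i = d by omega, qPoch_succ',
      show Y * q ^ (i + 1 + 1) = Y * q ^ (i + 1) * q by ring,
      show Y * q * q ^ (i + 1) = Y * q ^ (i + 1) * q by ring]
    ring

/-- The terminating `q`-Vandermonde sum. -/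
theorem q_vandermonde (q B Z : R) (s : ℕ) :
    ∑ i ∈ range (s + 1), qBinom q s i * ((-1) ^ i * q ^ i.choose 2 * qPoch B q i * Z ^ i *
      qPoch (B * Z * q ^ i) q (s - i)) = qPoch Z q s := by
  induction s generalizing Z with
  | zero => simp
  | succ s ih =>
    rw [sum_qBinom_succ, qPoch_succ', ← ih (Z * q), mul_sum]
    refine sum_congr rfl fun i hi => ?_
    obtain ⟨d, rfl⟩ : ∃ d, s = i + d := ⟨s - i, by have := mem_range.1 hi; omega⟩
    rw [show i + d + 1 - i = d + 1 by omega, show i + d + 1 - (i + 1) = d by omega,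
      show i + d - i = d by omega, qPoch_succ' (B * Z * q ^ i), qPoch_succ B,
      show B * Z * q ^ (i + 1) = B * Z * q ^ i * q by ring,
      show B * (Z * q) * q ^ i = B * Z * q ^ i * q by ring, Nat.choose_succ_succ' i 1,
      Nat.choose_one_right]
    ring

/-- One step of the Bailey chain, acting on sequences. -/
def baileyStep (q y : R) (u : ℕ → R) (n : ℕ) : R :=
  ∑ k ∈ range (n + 1), qBinom q n k * (y ^ k * q ^ k ^ 2) * u k

/-- The sequence `n ↦ c_n(x)` such that `X_m^{(b-1)} = ∑_n (q)_n c_n(1)`. -/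
def innerSum (m b : ℕ) (q x : R) : ℕ → R :=
  (baileyStep q (x ^ 2 * q))^[m - b] fun n =>
    (baileyStep q (x ^ 2))^[b] (fun k => if k = 0 then 1 else 0) (n + 1)

end Ring

section Field

variable {K : Type*} [Field K] {q : K}

/-- The equation `w * q ^ M = 1` encodes `w = q^{-M}`. As `q` is not a root of unity, the only
vanishing factor `1 - w q^i` is the one at `i = M`, and this controls every denominator below. -/
theorem eq_of_mul_pow_eq_one (hq : ∀ i, q ^ (i + 1) ≠ 1) {w : K} {M i : ℕ}
    (hM : w * q ^ M = 1) (hi : w * q ^ i = 1) : i = M := by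
  have hw : w ≠ 0 := left_ne_zero_of_mul_eq_one hM
  have hq0 : ∀ k, q ^ (k + 1) = 1 → False := fun k h => hq k h
  rcases lt_trichotomy i M with h | h | h
  · obtain ⟨d, rfl⟩ : ∃ d, M = i + (d + 1) := ⟨M - i - 1, by omega⟩
    rw [pow_add, ← mul_assoc, hi, one_mul] at hM
    exact (hq0 _ hM).elim
  · exact h
  · obtain ⟨d, rfl⟩ : ∃ d, i = M + (d + 1) := ⟨i - M - 1, by omega⟩
    rw [pow_add, ← mul_assoc, hM, one_mul] at hi
    exact (hq0 _ hi).elim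

theorem qPoch_ne_zero (hq : ∀ i, q ^ (i + 1) ≠ 1) {w : K} {M : ℕ} (hM : w * q ^ M = 1) {a b : ℕ}
    (h : a + b ≤ M) : qPoch (w * q ^ a) q b ≠ 0 := by
  rw [qPoch, prod_ne_zero_iff]
  intro i hi h0
  have := mem_range.1 hi
  rw [sub_eq_zero, mul_assoc, ← pow_add] at h0
  have := eq_of_mul_pow_eq_one hq hM h0.symm
  omega

theorem qPoch_self_ne_zero (hq : ∀ i, q ^ (i + 1) ≠ 1) (n : ℕ) : qPoch q q n ≠ 0 := by
  rw [qPoch, prod_ne_zero_iff]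
  intro i _ h0
  rw [sub_eq_zero, ← pow_succ'] at h0
  exact hq i h0.symm

theorem qBinom_mul_qBinom (hq : ∀ i, q ^ (i + 1) ≠ 1) (r s i : ℕ) (hi : i ≤ s) :
    qBinom q (r + s) (r + i) * qBinom q (r + i) r = qBinom q (r + s) r * qBinom q s i := by
  have h1 := qBinom_mul q (r + s) (r + i) (by omega)
  have h2 := qBinom_mul q (r + i) r (by omega)
  have h3 := qBinom_mul q (r + s) r (by omega)
  have h4 := qBinom_mul q s i hi
  rw [show r + s - (r + i) = s - i by omega] at h1
  rw [show r + i - r = i by omega] at h2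
  rw [show r + s - r = s by omega] at h3
  have hr := qPoch_self_ne_zero hq r
  have hi' := qPoch_self_ne_zero hq i
  have hsi := qPoch_self_ne_zero hq (s - i)
  refine mul_right_cancel₀ (mul_ne_zero (mul_ne_zero hr hi') hsi) ?_
  calc _ = qBinom q (r + s) (r + i) * (qBinom q (r + i) r * (qPoch q q r * qPoch q q i) *
        qPoch q q (s - i)) := by ring
    _ = qPoch q q (r + s) := by rw [h2, h1]
    _ = qBinom q (r + s) r * (qPoch q q r *
        (qBinom q s i * (qPoch q q i * qPoch q q (s - i)))) := by rw [h4, h3]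
    _ = _ := by ring

/-- An eigenvector of `baileyStep q y`, of eigenvalue `y ^ r * q ^ r ^ 2`. -/
def baileyEigen (q y : K) (r n : ℕ) : K :=
  qBinom q n r / (qPoch (y * q ^ r) q r * qPoch (y * q ^ (2 * r + 1)) q (n - r))

theorem baileyEigen_eq_zero (q y : K) {r n : ℕ} (h : n < r) : baileyEigen q y r n = 0 := by
  rw [baileyEigen, qBinom_eq_zero _ _ _ h, zero_div]

/-- Only `k = r + i` with `i ≥ 0` contributes. Regrouping the product of two q-binomials by
`qBinom_mul_qBinom` leaves the sum `sum_qBinom_mul_qPoch` at `Y = y q^{2r}`, which equals 1. -/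
theorem baileyStep_baileyEigen (hq : ∀ i, q ^ (i + 1) ≠ 1) (y : K) (r n : ℕ)
    (h : qPoch (y * q ^ (2 * r + 1)) q (n - r) ≠ 0) :
    baileyStep q y (baileyEigen q y r) n = y ^ r * q ^ r ^ 2 * baileyEigen q y r n := by
  rcases lt_or_ge n r with hn | hn
  · rw [baileyEigen_eq_zero q y hn, baileyStep, mul_zero]
    refine sum_eq_zero fun k hk => ?_
    rw [baileyEigen_eq_zero q y (by have := mem_range.1 hk; omega), mul_zero]
  obtain ⟨s, rfl⟩ := Nat.exists_eq_add_of_le hn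
  rw [baileyStep, add_assoc, sum_range_add, sum_eq_zero, zero_add]
  swap
  · intro k hk
    rw [baileyEigen_eq_zero q y (mem_range.1 hk), mul_zero]
  rw [Nat.add_sub_cancel_left] at h
  have key := sum_qBinom_mul_qPoch q (y * q ^ (2 * r)) s
  rw [← mul_one (_ * baileyEigen _ _ _ _), ← key, mul_sum]
  refine sum_congr rfl fun i hi => ?_
  have hi' : i ≤ s := by have := mem_range.1 hi; omega
  have hsplit : qPoch (y * q ^ (2 * r + 1)) q s = qPoch (y * q ^ (2 * r + 1)) q i *
      qPoch (y * q ^ (2 * r) * q ^ (i + 1)) q (s - i) := by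
    rw [show y * q ^ (2 * r) * q ^ (i + 1) = y * q ^ (2 * r + 1) * q ^ i by ring, ← qPoch_add,
      Nat.add_sub_cancel' hi']
  have h0 : qPoch (y * q ^ (2 * r + 1)) q i ≠ 0 := fun h0 => h (by rw [hsplit, h0, zero_mul])
  have h1 : qPoch (y * q ^ (2 * r) * q ^ (i + 1)) q (s - i) ≠ 0 :=
    fun h0 => h (by rw [hsplit, h0, mul_zero])
  rw [baileyEigen, baileyEigen, Nat.add_sub_cancel_left, Nat.add_sub_cancel_left, hsplit]
  have hb := qBinom_mul_qBinom hq r s i hi'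
  rw [show y ^ (r + i) * q ^ (r + i) ^ 2 =
    y ^ r * q ^ r ^ 2 * ((y * q ^ (2 * r)) ^ i * q ^ i ^ 2) by ring]
  generalize qPoch (y * q ^ (2 * r) * q ^ (i + 1)) q (s - i) = A at *
  generalize qPoch (y * q ^ (2 * r + 1)) q i = B at *
  generalize qPoch (y * q ^ r) q r = C at *
  rw [← div_div, ← div_div, ← mul_div_assoc, div_eq_iff h0]
  calc _ = (y ^ r * q ^ r ^ 2 * ((y * q ^ (2 * r)) ^ i * q ^ i ^ 2)) / C *
        (qBinom q (r + s) (r + i) * qBinom q (r + i) r) := by ring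
    _ = (y ^ r * q ^ r ^ 2 * ((y * q ^ (2 * r)) ^ i * q ^ i ^ 2)) / C *
        (qBinom q (r + s) r * qBinom q s i) * ((A / A) * (B / B)) := by
        rw [hb, div_self h1, div_self h0]; ring
    _ = _ := by field_simp

/-- A Bailey step is lower triangular, so an eigenvector expansion valid only up to `B` survives
iteration. The bound is needed because for `y = q^{-2N}` the denominators vanish further out. -/
theorem iterate_baileyStep (hq : ∀ i, q ^ (i + 1) ≠ 1) (y : K) (B : ℕ) (c u : ℕ → K)
    (hne : ∀ r n, r ≤ n → n ≤ B → qPoch (y * q ^ (2 * r + 1)) q (n - r) ≠ 0)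
    (hu : ∀ n ≤ B, u n = ∑ r ∈ range (B + 1), c r * baileyEigen q y r n) (b : ℕ) :
    ∀ n ≤ B, (baileyStep q y)^[b] u n =
      ∑ r ∈ range (B + 1), c r * (y ^ r * q ^ r ^ 2) ^ b * baileyEigen q y r n := by
  induction b with
  | zero => intro n hn; simpa using hu n hn
  | succ b ih =>
    intro n hn
    rw [Function.iterate_succ_apply', baileyStep]
    have : ∀ k ∈ range (n + 1), qBinom q n k * (y ^ k * q ^ k ^ 2) * (baileyStep q y)^[b] u k =
        ∑ r ∈ range (B + 1), c r * (y ^ r * q ^ r ^ 2) ^ b *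
          (qBinom q n k * (y ^ k * q ^ k ^ 2) * baileyEigen q y r k) := fun k hk => by
      rw [ih k (by have := mem_range.1 hk; omega), mul_sum]
      exact sum_congr rfl fun r _ => by ring
    rw [sum_congr rfl this, sum_comm]
    refine sum_congr rfl fun r _ => ?_
    rw [← mul_sum]
    have h2 : baileyStep q y (baileyEigen q y r) n = y ^ r * q ^ r ^ 2 * baileyEigen q y r n := by
      refine baileyStep_baileyEigen hq y r n ?_
      rcases le_or_gt r n with h | h
      · exact hne r n h hn
      · rw [show n - r = 0 by omega]; simp
    rw [baileyStep] at h2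
    rw [h2]; ring

theorem sum_mul_range_succ (f d S : ℕ → K) (M : ℕ)
    (hS : ∀ k ≤ M, ∑ r ∈ range (k + 1), d r = S k) :
    ∑ r ∈ range (M + 1), f r * d r =
      f M * S M + ∑ r ∈ range M, (f r - f (r + 1)) * S r := by
  induction M with
  | zero => have := hS 0 le_rfl
            simp at this
            simp [this]
  | succ M ih =>
    have h1 := hS (M + 1) le_rfl
    rw [sum_range_succ, hS M (by omega)] at h1
    rw [sum_range_succ, ih fun k hk => hS k (by omega), sum_range_succ _ M, ← h1]
    ring

end Field

end QSeries

/-! ### The terminating identity at `x = q^{-N}` -/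

section QSeriesEval

open Finset

variable {K : Type*} [Field K] {q : K}

/-- The partial sums of the Bailey expansion of the unit sequence at `n + 1`. -/
def unitPartial (q y : K) (r n : ℕ) : K :=
  (-1) ^ r * q ^ (r + 1).choose 2 * qBinom q n r / qPoch (y * q ^ (r + 1)) q (n + 1)

/-- The sum telescopes. After the three denominators are extended to a common one, the increment is
a polynomial identity that follows from equating the two Pascal rules. -/
theorem sum_baileyEigen_eq_unitPartial (hq : ∀ i, q ^ (i + 1) ≠ 1) {y : K} {N : ℕ}
    (hy : y * q ^ (2 * N) = 1) {n : ℕ} (hn : n + 1 ≤ N) (r : ℕ) (hr : r ≤ n) :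
    ∑ s ∈ range (r + 1), (-1) ^ s * q ^ s.choose 2 * baileyEigen q y s (n + 1) =
      unitPartial q y r n := by
  induction r with
  | zero => simp [baileyEigen, unitPartial]
  | succ r ih =>
    rw [sum_range_succ, ih (by omega), unitPartial, unitPartial, baileyEigen,
      show n + 1 - (r + 1) = n - r by omega]
    obtain ⟨d, rfl⟩ : ∃ d, n = r + 1 + d := ⟨n - r - 1, by omega⟩
    rw [show r + 1 + d - r = d + 1 by omega]
    have e1 := qPoch_succ' (y * q ^ (r + 1)) q (r + 1 + d + 1)
    have e2 := qPoch_succ (y * q ^ (r + 1)) q (r + 1 + d + 1)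
    have e3 : qPoch (y * q ^ (r + 1)) q (r + 1 + d + 1 + 1) = qPoch (y * q ^ (r + 1)) q (r + 1) *
        ((1 - y * q ^ (2 * (r + 1))) * qPoch (y * q ^ (2 * (r + 1) + 1)) q (d + 1)) := by
      rw [show r + 1 + d + 1 + 1 = (r + 1) + ((d + 1) + 1) by ring, qPoch_add,
        qPoch_succ' (y * q ^ (r + 1) * q ^ (r + 1))]
      congr 3 <;> ring
    -- The exponents in this product stay below `2r + d + 4`, which is at most `2N` because `r + d +
    -- 2 = n + 1 ≤ N`.
    have hF := qPoch_ne_zero hq hy (a := r + 1) (b := r + 1 + d + 1 + 1) (by omega)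
    rw [show y * q ^ (r + 1) * q = y * q ^ (r + 1 + 1) by ring] at e1
    have p1 := qBinom_succ_succ q (r + 1 + d) r
    have p2 := qBinom_succ_succ' q (r + 1 + d) r (by omega)
    rw [show r + 1 + d - r = d + 1 by omega] at p2
    have c1 : q ^ (r + 1 + 1).choose 2 = q ^ (r + 1).choose 2 * q ^ (r + 1) := by
      rw [Nat.choose_succ_succ' (r + 1) 1, Nat.choose_one_right]; ring
    rw [c1, ← mul_div_assoc]
    generalize q ^ (r + 1).choose 2 = Q at *
    generalize qBinom q (r + 1 + d + 1) (r + 1) = b0 at *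
    generalize qBinom q (r + 1 + d) (r + 1) = b1 at *
    generalize qBinom q (r + 1 + d) r = b2 at *
    generalize qPoch (y * q ^ (r + 1)) q (r + 1 + d + 1 + 1) = F at *
    have h1 : qPoch (y * q ^ (r + 1)) q (r + 1 + d + 1) ≠ 0 := fun h => hF (by rw [e2, h, zero_mul])
    have h2 : qPoch (y * q ^ (r + 1 + 1)) q (r + 1 + d + 1) ≠ 0 :=
      fun h => hF (by rw [e1, h, mul_zero])
    have h3 : qPoch (y * q ^ (r + 1)) q (r + 1) * qPoch (y * q ^ (2 * (r + 1) + 1)) q (d + 1) ≠ 0 :=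
      fun h => hF (by rw [e3]; linear_combination (1 - y * q ^ (2 * (r + 1))) * h)
    have i1 : ∀ t : K, t / qPoch (y * q ^ (r + 1)) q (r + 1 + d + 1) =
        t * (1 - y * q ^ (r + 1) * q ^ (r + 1 + d + 1)) / F := fun t => by
      rw [div_eq_div_iff h1 hF, e2]; ring
    have i2 : ∀ t : K, t / qPoch (y * q ^ (r + 1 + 1)) q (r + 1 + d + 1) =
        t * (1 - y * q ^ (r + 1)) / F := fun t => by
      rw [div_eq_div_iff h2 hF, e1]; ring
    have i3 : ∀ t : K, t / (qPoch (y * q ^ (r + 1)) q (r + 1) *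
        qPoch (y * q ^ (2 * (r + 1) + 1)) q (d + 1)) =
        t * (1 - y * q ^ (2 * (r + 1))) / F := fun t => by
      rw [div_eq_div_iff h3 hF, e3]; ring
    rw [i1, i2, i3, ← add_div]
    congr 1
    have p3 : q ^ (r + 1) * b1 + b2 = b1 + q ^ (d + 1) * b2 := by rw [← p1, p2]
    rw [p1]
    simp only [pow_succ, pow_add, pow_mul, mul_pow] at p3 ⊢
    linear_combination ((-1) ^ r * Q * y * q ^ (2 * r) * q ^ 2) * p3

theorem sum_baileyEigen_eq_zero (hq : ∀ i, q ^ (i + 1) ≠ 1) {y : K} {N : ℕ}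
    (hy : y * q ^ (2 * N) = 1) {n : ℕ} (hn : n + 1 ≤ N) :
    ∑ s ∈ range (n + 2), (-1) ^ s * q ^ s.choose 2 * baileyEigen q y s (n + 1) = 0 := by
  rw [sum_range_succ, sum_baileyEigen_eq_unitPartial hq hy hn n le_rfl, unitPartial, baileyEigen,
    qBinom_self, qBinom_self, Nat.sub_self, qPoch_zero]
  ring

theorem unit_eq_sum_baileyEigen (hq : ∀ i, q ^ (i + 1) ≠ 1) {y : K} {N : ℕ}
    (hy : y * q ^ (2 * N) = 1) (n : ℕ) (hn : n ≤ N) :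
    (if n = 0 then 1 else 0 : K) =
      ∑ s ∈ range (N + 1), (-1) ^ s * q ^ s.choose 2 * baileyEigen q y s n := by
  rcases n with _ | n
  · rw [sum_eq_single 0]
    · simp [baileyEigen]
    · intro b _ hb
      rw [baileyEigen_eq_zero q y (by omega), mul_zero]
    · simp
  · rw [if_neg (by omega), ← sum_subset (range_mono (show n + 2 ≤ N + 1 by omega)),
      sum_baileyEigen_eq_zero hq hy hn]
    intro s _ hs
    rw [baileyEigen_eq_zero q y (by simp only [mem_range] at hs; omega), mul_zero]

/-- Abel summation trades the eigenvectors at `n + 1` for their partial sums, with differences of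
eigenvalue powers as coefficients. The partial sums are what the second half of the chain can use,
by `unitPartial_eq_baileyEigen`. -/
theorem iterate_baileyStep_unit (hq : ∀ i, q ^ (i + 1) ≠ 1) {y : K} {N : ℕ}
    (hy : y * q ^ (2 * N) = 1) (b n : ℕ) (hn : n + 1 ≤ N) :
    (baileyStep q y)^[b] (fun k => if k = 0 then 1 else 0) (n + 1) =
      ∑ r ∈ range (n + 1), ((y ^ r * q ^ r ^ 2) ^ b - (y ^ (r + 1) * q ^ (r + 1) ^ 2) ^ b) *
        unitPartial q y r n := by
  rw [iterate_baileyStep hq y N (fun s => (-1) ^ s * q ^ s.choose 2) _ _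
    (unit_eq_sum_baileyEigen hq hy) b (n + 1) hn,
    ← sum_subset (range_mono (show n + 1 + 1 ≤ N + 1 by omega))]
  -- The complete sum, of index `n + 1`, is zero; hence the default value 0, and no boundary term
  -- remains.
  · have := sum_mul_range_succ (fun r => (y ^ r * q ^ r ^ 2) ^ b)
      (fun s => (-1) ^ s * q ^ s.choose 2 * baileyEigen q y s (n + 1))
      (fun r => if r ≤ n then unitPartial q y r n else 0) (n + 1) fun k hk => by
        split_ifs with h
        · exact sum_baileyEigen_eq_unitPartial hq hy hn k h
        · obtain rfl : k = n + 1 := by omega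
          exact sum_baileyEigen_eq_zero hq hy hn
    simp only [add_le_iff_nonpos_right, nonpos_iff_eq_zero, one_ne_zero, if_false, mul_zero,
      zero_add] at this
    refine (sum_congr rfl fun r _ => ?_).trans (this.trans (sum_congr rfl fun r hr => ?_))
    · ring
    · rw [if_pos (by have := mem_range.1 hr; omega)]
  · intro s _ hs
    rw [baileyEigen_eq_zero q y (by simpa using hs), mul_zero]
  · intro r n hrn hnN
    rcases Nat.eq_or_lt_of_le hrn with rfl | h
    · simp
    · exact qPoch_ne_zero hq hy (by omega)

/-- This is the change of parameter in the middle of the chain: up to a factor free of `n`, the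
partial sums for `y` at `n + 1` are eigenvectors for `y q` at `n`. -/
theorem unitPartial_eq_baileyEigen (q y : K) (r n : ℕ) :
    unitPartial q y r n = (-1) ^ r * q ^ (r + 1).choose 2 / (1 - y * q ^ (2 * r + 1)) *
      baileyEigen q (y * q) r n := by
  rcases lt_or_ge n r with h | h
  · rw [baileyEigen_eq_zero _ _ h, unitPartial, qBinom_eq_zero _ _ _ h]; simp
  obtain ⟨d, rfl⟩ := Nat.exists_eq_add_of_le h
  rw [unitPartial, baileyEigen, Nat.add_sub_cancel_left]
  have e : qPoch (y * q ^ (r + 1)) q (r + d + 1) = (1 - y * q ^ (2 * r + 1)) *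
      (qPoch (y * q * q ^ r) q r * qPoch (y * q * q ^ (2 * r + 1)) q d) := by
    rw [add_assoc, qPoch_add, qPoch_succ', show y * q ^ (r + 1) * q ^ r = y * q ^ (2 * r + 1) by ring,
      show y * q ^ (r + 1) = y * q * q ^ r by ring,
      show y * q ^ (2 * r + 1) * q = y * q * q ^ (2 * r + 1) by ring]
    ring
  rw [e, div_mul_div_comm]

theorem innerSum_eq (hq : ∀ i, q ^ (i + 1) ≠ 1) {x : K} {N : ℕ} (hx : x * q ^ N = 1)
    (m b n : ℕ) (hn : n < N) :
    innerSum m b q x n = ∑ r ∈ range N,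
      ((x ^ 2) ^ r * q ^ r ^ 2) ^ b * (1 - (x ^ 2 * q ^ (2 * r + 1)) ^ b) *
      ((x ^ 2 * q) ^ r * q ^ r ^ 2) ^ (m - b) * unitPartial q (x ^ 2) r n := by
  have hy : x ^ 2 * q ^ (2 * N) = 1 := by rw [mul_comm 2 N, pow_mul, ← mul_pow, hx, one_pow]
  -- The new parameter is `x² q = q^{-(2N-1)}`, so the expansion holds only up to `N - 1`.
  obtain ⟨B, rfl⟩ : ∃ B, N = B + 1 := ⟨N - 1, by omega⟩
  have hyq : x ^ 2 * q * q ^ (2 * B + 1) = 1 := by rw [← hy]; ring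
  rw [innerSum, iterate_baileyStep hq (x ^ 2 * q) B (fun r =>
    ((x ^ 2) ^ r * q ^ r ^ 2) ^ b * (1 - (x ^ 2 * q ^ (2 * r + 1)) ^ b) *
    ((-1) ^ r * q ^ (r + 1).choose 2 / (1 - x ^ 2 * q ^ (2 * r + 1)))) _ _ _ (m - b) n (by omega)]
  · refine sum_congr rfl fun r _ => ?_
    rw [unitPartial_eq_baileyEigen q _ r n]
    ring
  · intro r n hrn hnB
    exact qPoch_ne_zero hq hyq (by omega)
  · intro n hn
    rw [iterate_baileyStep_unit hq hy b n (by omega),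
      ← sum_subset (range_mono (show n + 1 ≤ B + 1 by omega))]
    · refine sum_congr rfl fun r _ => ?_
      rw [unitPartial_eq_baileyEigen q _ r n]
      rw [show (x ^ 2) ^ (r + 1) * q ^ (r + 1) ^ 2 =
        (x ^ 2) ^ r * q ^ r ^ 2 * (x ^ 2 * q ^ (2 * r + 1)) by ring, mul_pow _ (x ^ 2 * _)]
      ring
    · intro s _ hs
      rw [baileyEigen_eq_zero _ _ (by simpa using hs), mul_zero]

theorem qPoch_mul_qPoch_self (q w : K) (M i : ℕ) (hM : w * q ^ M = 1) (hi : i ≤ M) :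
    qPoch w q i * qPoch q q (M - i) = (-1) ^ i * q ^ i.choose 2 * w ^ i * qPoch q q M := by
  induction i with
  | zero => simp
  | succ i ih =>
    obtain ⟨d, rfl⟩ : ∃ d, M = i + d + 1 := ⟨M - i - 1, by omega⟩
    have := ih (by omega)
    rw [show i + d + 1 - i = d + 1 by omega, qPoch_succ q q d] at this
    rw [show i + d + 1 - (i + 1) = d by omega, qPoch_succ, Nat.choose_succ_succ' i 1,
      Nat.choose_one_right]
    have e : 1 - w * q ^ i = - (w * q ^ i) * (1 - q * q ^ d) := by
      have : w * q ^ i * (q * q ^ d) = 1 := by rw [← hM]; ring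
      linear_combination -this
    rw [e]
    linear_combination (-(w * q ^ i)) * this

/-- With `n = r + i` and `N = r + M + 1`, the factor `(x q^{r+1})_i = (q^{-M})_i` reverses into a
q-binomial of upper index `M`, and `q_vandermonde` applies with `B = q^{r+1}`, `Z = x² q^{r+1}`. -/
theorem sum_qPoch_mul_unitPartial (hq : ∀ i, q ^ (i + 1) ≠ 1) {x : K} {N : ℕ}
    (hx : x * q ^ N = 1) (r : ℕ) (hr : r < N) :
    ∑ n ∈ range N, qPoch x q (n + 1) * x ^ n * unitPartial q (x ^ 2) r n =
      (-1) ^ r * q ^ (r + 1).choose 2 * x ^ r := by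
  obtain ⟨M, rfl⟩ : ∃ M, N = r + (M + 1) := ⟨N - r - 1, by omega⟩
  have hy : x ^ 2 * q ^ (2 * (r + (M + 1))) = 1 := by
    rw [mul_comm 2, pow_mul, ← mul_pow, hx, one_pow]
  have hw : x * q ^ (r + 1) * q ^ M = 1 := by rw [← hx]; ring
  rw [sum_range_add, sum_eq_zero, zero_add]
  swap
  · intro k hk
    rw [unitPartial, qBinom_eq_zero _ _ _ (mem_range.1 hk)]; simp
  have key := q_vandermonde q (q ^ (r + 1)) (x ^ 2 * q ^ (r + 1)) M
  -- Since `x q^N = 1`, the product restarts at `x` after `M` factors; this makes the Vandermonde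
  -- value cancel the common denominator.
  have hZ : qPoch (x ^ 2 * q ^ (r + 1)) q (r + M + 1) = qPoch (x ^ 2 * q ^ (r + 1)) q M *
      qPoch x q (r + 1) := by
    rw [show r + M + 1 = M + (r + 1) by ring, qPoch_add]
    congr 2
    calc _ = x * (x * q ^ (r + (M + 1))) := by ring
      _ = x := by rw [hx, mul_one]
  have hZ' : qPoch (x ^ 2 * q ^ (r + 1)) q (r + M + 1) = qPoch (x ^ 2 * q ^ (r + 1)) q (r + 1) *
      qPoch (x ^ 2 * q ^ (2 * r + 2)) q M := by
    rw [show r + M + 1 = (r + 1) + M by ring, qPoch_add]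
    congr 2
    ring
  have hZ0 : qPoch (x ^ 2 * q ^ (r + 1)) q (r + M + 1) ≠ 0 := qPoch_ne_zero hq hy (by omega)
  have hx0 : qPoch x q (r + 1) ≠ 0 := fun h => hZ0 (by rw [hZ, h, mul_zero])
  have hterm : ∀ i ∈ range (M + 1), qPoch x q (r + i + 1) * x ^ (r + i) *
      unitPartial q (x ^ 2) r (r + i) = ((-1) ^ r * q ^ (r + 1).choose 2 * x ^ r) *
      (qPoch x q (r + 1) / qPoch (x ^ 2 * q ^ (r + 1)) q (r + M + 1)) *
      (qBinom q M i * ((-1) ^ i * q ^ i.choose 2 * qPoch (q ^ (r + 1)) q i *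
        (x ^ 2 * q ^ (r + 1)) ^ i *
        qPoch (q ^ (r + 1) * (x ^ 2 * q ^ (r + 1)) * q ^ i) q (M - i))) := by
    intro i hi
    have hi' : i ≤ M := by have := mem_range.1 hi; omega
    have a1 : qPoch x q (r + i + 1) = qPoch x q (r + 1) * qPoch (x * q ^ (r + 1)) q i := by
      rw [show r + i + 1 = r + 1 + i by ring, qPoch_add]
    have a2 : qPoch (x ^ 2 * q ^ (r + 1)) q (r + M + 1) =
        qPoch (x ^ 2 * q ^ (r + 1)) q (r + i + 1) *
        qPoch (q ^ (r + 1) * (x ^ 2 * q ^ (r + 1)) * q ^ i) q (M - i) := by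
      rw [show r + M + 1 = r + i + 1 + (M - i) by omega, qPoch_add]
      congr 2
      ring
    have h1 := qPoch_mul_qPoch_self q _ M i hw hi'
    have h2 := qBinom_mul q M i hi'
    have h3 := qBinom_mul q (r + i) r (by omega)
    have h4 : qPoch q q (r + i) = qPoch q q r * qPoch (q ^ (r + 1)) q i := by
      rw [qPoch_add, pow_succ']
    rw [Nat.add_sub_cancel_left, h4] at h3
    have n1 := qPoch_self_ne_zero hq r
    have n2 := qPoch_self_ne_zero hq i
    have n3 := qPoch_self_ne_zero hq (M - i)
    have h5 : qBinom q (r + i) r * qPoch q q i = qPoch (q ^ (r + 1)) q i :=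
      mul_left_cancel₀ n1 (by rw [← h3]; ring)
    have h6 : qPoch (x * q ^ (r + 1)) q i * qBinom q (r + i) r = (-1) ^ i * q ^ i.choose 2 *
        (x * q ^ (r + 1)) ^ i * qBinom q M i * qPoch (q ^ (r + 1)) q i := by
      refine mul_right_cancel₀ (mul_ne_zero n2 n3) ?_
      rw [← h2] at h1
      calc _ = qPoch (x * q ^ (r + 1)) q i * qPoch q q (M - i) *
            (qBinom q (r + i) r * qPoch q q i) := by ring
        _ = _ := by rw [h1, h5]; ring
    rw [a2] at hZ0 ⊢
    have n4 := left_ne_zero_of_mul hZ0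
    have n5 := right_ne_zero_of_mul hZ0
    rw [unitPartial, a1]
    generalize qPoch (x ^ 2 * q ^ (r + 1)) q (r + i + 1) = A at *
    generalize qPoch (q ^ (r + 1) * (x ^ 2 * q ^ (r + 1)) * q ^ i) q (M - i) = B at *
    calc _ = (-1) ^ r * q ^ (r + 1).choose 2 * x ^ (r + i) * qPoch x q (r + 1) / A *
          (qPoch (x * q ^ (r + 1)) q i * qBinom q (r + i) r) := by ring
      _ = _ := by rw [h6]; field_simp; ring
  rw [add_assoc] at *
  rw [sum_congr rfl hterm, ← mul_sum, key, hZ, mul_assoc, div_mul_eq_mul_div,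
    mul_comm (qPoch x q (r + 1)), ← hZ, div_self hZ0, mul_one]

/-- The terminating case `x = q ^ (-N)` of the two-variable theta identity. -/
theorem sum_qPoch_mul_innerSum (hq : ∀ i, q ^ (i + 1) ≠ 1) {x : K} {N : ℕ}
    (hx : x * q ^ N = 1) (m b : ℕ) :
    ∑ n ∈ range N, qPoch x q (n + 1) * x ^ n * innerSum m b q x n =
      ∑ j ∈ range N, (-1) ^ j * q ^ (j + 1).choose 2 * x ^ j *
        (((x ^ 2) ^ j * q ^ j ^ 2) ^ b * (1 - (x ^ 2 * q ^ (2 * j + 1)) ^ b) *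
        ((x ^ 2 * q) ^ j * q ^ j ^ 2) ^ (m - b)) := by
  have : ∀ n ∈ range N, qPoch x q (n + 1) * x ^ n * innerSum m b q x n =
      ∑ j ∈ range N, (((x ^ 2) ^ j * q ^ j ^ 2) ^ b * (1 - (x ^ 2 * q ^ (2 * j + 1)) ^ b) *
        ((x ^ 2 * q) ^ j * q ^ j ^ 2) ^ (m - b)) *
        (qPoch x q (n + 1) * x ^ n * unitPartial q (x ^ 2) j n) := fun n hn => by
    rw [innerSum_eq hq hx m b n (mem_range.1 hn), mul_sum]
    exact sum_congr rfl fun r _ => by ring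
  rw [sum_congr rfl this, sum_comm]
  refine sum_congr rfl fun r hr => ?_
  rw [← mul_sum, sum_qPoch_mul_unitPartial hq hx r (mem_range.1 hr)]
  ring

end QSeriesEval

/-! ### Values `L(-p, χ)` and the functional they define on polynomials -/

section LValues

open Finset

section ExpRescale

variable {A : Type*} [CommRing A] [Algebra ℚ A]

/-- The formal power series `e^{c t}` over a `ℚ`-algebra. -/
noncomputable def expMul (c : A) : A⟦X⟧ := PowerSeries.rescale c (PowerSeries.exp A)

theorem expMul_mul (c d : A) : expMul c * expMul d = expMul (c + d) :=
  PowerSeries.exp_mul_exp_eq_exp_add c d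

@[simp] theorem expMul_zero : expMul (0 : A) = 1 := by
  simp [expMul]

theorem expMul_pow (c : A) (n : ℕ) : expMul c ^ n = expMul (n * c) := by
  induction n with
  | zero => simp
  | succ n ih => rw [pow_succ, ih, expMul_mul]; push_cast; ring_nf

theorem coeff_expMul (c : A) (n : ℕ) :
    PowerSeries.coeff n (expMul c) = algebraMap ℚ A (1 / n.factorial) * c ^ n := by
  rw [expMul, PowerSeries.coeff_rescale, PowerSeries.coeff_exp, mul_comm]

theorem constantCoeff_expMul (c : A) : PowerSeries.constantCoeff (expMul c) = 1 := by
  rw [← PowerSeries.coeff_zero_eq_constantCoeff_apply, coeff_expMul]; simp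

theorem rescale_expMul (c d : A) : PowerSeries.rescale c (expMul d) = expMul (d * c) := by
  rw [expMul, PowerSeries.rescale_rescale, expMul]

theorem map_expMul {B : Type*} [CommRing B] [Algebra ℚ B] (f : A →+* B) (c : A) :
    PowerSeries.map f (expMul c) = expMul (f c) := by
  ext n
  rw [PowerSeries.coeff_map, coeff_expMul, coeff_expMul, map_mul, map_pow]
  congr 1
  exact f.map_rat_algebraMap _

end ExpRescale

theorem expSeries_eq (c : ℂ) : expSeries c = expMul c := rfl

theorem chi_natCast (m a : ℕ) (ha : a < m) (r : ℕ) : chi m a (r : ZMod (8 * m + 4)) =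
    if r % (8 * m + 4) = 2 * m - 2 * a - 1 then 1
    else if r % (8 * m + 4) = 2 * m + 2 * a + 3 then -1
    else if r % (8 * m + 4) = 6 * m - 2 * a + 1 then -1
    else if r % (8 * m + 4) = 6 * m + 2 * a + 5 then 1
    else 0 := by
  have key : ∀ c < 8 * m + 4, (r : ZMod (8 * m + 4)) = (c : ℕ) ↔ r % (8 * m + 4) = c :=
    fun c hc => by rw [ZMod.natCast_eq_natCast_iff', Nat.mod_eq_of_lt hc]
  have e1 : (2 * m - 2 * a - 1 : ZMod (8 * m + 4)) = ((2 * m - 2 * a - 1 : ℕ) : ZMod _) := by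
    rw [Nat.cast_sub (by omega), Nat.cast_sub (by omega)]; push_cast; rfl
  have e2 : (2 * m + 2 * a + 3 : ZMod (8 * m + 4)) = ((2 * m + 2 * a + 3 : ℕ) : ZMod _) := by
    push_cast; rfl
  have e3 : (6 * m - 2 * a + 1 : ZMod (8 * m + 4)) = ((6 * m - 2 * a + 1 : ℕ) : ZMod _) := by
    rw [Nat.cast_add, Nat.cast_sub (by omega)]; push_cast; rfl
  have e4 : (6 * m + 2 * a + 5 : ZMod (8 * m + 4)) = ((6 * m + 2 * a + 5 : ℕ) : ZMod _) := by
    push_cast; rfl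
  simp only [chi, e1, e2, e3, e4]
  rw [if_congr (key _ (by omega)) rfl (if_congr (key _ (by omega)) rfl
    (if_congr (key _ (by omega)) rfl (if_congr (key _ (by omega)) rfl rfl)))]

/-- Antiperiodicity under half the period is the source of the factor `1 + e^{(4m+2)t}`, of the
recursion for `thetaSeries` and of the alternating signs in the asymptotics. -/
theorem chi_add_half (m a : ℕ) (ha : a < m) (r : ℕ) :
    chi m a ((r + (4 * m + 2) : ℕ) : ZMod (8 * m + 4)) = - chi m a (r : ZMod (8 * m + 4)) := by
  rw [chi_natCast m a ha, chi_natCast m a ha]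
  have h1 := Nat.mod_lt r (show 8 * m + 4 > 0 by omega)
  have h2 : (r + (4 * m + 2)) % (8 * m + 4) = if r % (8 * m + 4) < 4 * m + 2 then
      r % (8 * m + 4) + (4 * m + 2) else r % (8 * m + 4) - (4 * m + 2) := by
    rw [Nat.add_mod, Nat.mod_eq_of_lt (show 4 * m + 2 < 8 * m + 4 by omega)]
    split_ifs with h
    · exact Nat.mod_eq_of_lt (by omega)
    · rw [Nat.mod_eq_sub_mod (by omega), Nat.mod_eq_of_lt (by omega)]; omega
  rw [h2]
  generalize r % (8 * m + 4) = s at *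
  split_ifs <;> first | rfl | omega

theorem sum_range_half_chi (m a : ℕ) (ha : a < m) {E : Type*} [AddCommGroup E] (g : ℕ → E) :
    ∑ r ∈ range (4 * m + 2), chi m a (r : ZMod (8 * m + 4)) • g r =
      g (2 * m - 2 * a - 1) - g (2 * m + 2 * a + 3) := by
  have : ∀ r ∈ range (4 * m + 2), chi m a (r : ZMod (8 * m + 4)) • g r =
      (if r = 2 * m - 2 * a - 1 then g r else 0) - (if r = 2 * m + 2 * a + 3 then g r else 0) := by
    intro r hr
    have hr := mem_range.1 hr
    rw [chi_natCast m a ha, Nat.mod_eq_of_lt (by omega)]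
    split_ifs <;> first | omega | simp
  rw [sum_congr rfl this, sum_sub_distrib, sum_ite_eq', sum_ite_eq',
    if_pos (mem_range.2 (by omega)), if_pos (mem_range.2 (by omega))]

theorem sum_range_chi (m a : ℕ) (ha : a < m) {E : Type*} [AddCommGroup E] (g : ℕ → E) :
    ∑ r ∈ range (8 * m + 4), chi m a (r : ZMod (8 * m + 4)) • g r =
      g (2 * m - 2 * a - 1) - g (2 * m + 2 * a + 3) -
      (g (2 * m - 2 * a - 1 + (4 * m + 2)) - g (2 * m + 2 * a + 3 + (4 * m + 2))) := by
  rw [show range (8 * m + 4) = range ((4 * m + 2) + (4 * m + 2)) by congr 1; ring, sum_range_add,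
    sum_range_half_chi m a ha,
    ← sum_range_half_chi m a ha fun r => g (r + (4 * m + 2)),
    sub_eq_add_neg _ (∑ r ∈ range _, _), ← sum_neg_distrib]
  congr 1
  refine sum_congr rfl fun r _ => ?_
  rw [add_comm (4 * m + 2) r, chi_add_half m a ha, neg_smul]

theorem chi_zero (m a : ℕ) (ha : a < m) : chi m a 0 = 0 := by
  have := chi_natCast m a ha 0
  rw [Nat.zero_mod] at this
  rw [← Nat.cast_zero, this]
  split_ifs <;> omega

theorem sum_Icc_chi (m a : ℕ) (ha : a < m) {E : Type*} [AddCommGroup E] (g : ℕ → E) :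
    ∑ r ∈ Icc 1 (8 * m + 4), chi m a (r : ZMod (8 * m + 4)) • g r =
      ∑ r ∈ range (8 * m + 4), chi m a (r : ZMod (8 * m + 4)) • g r := by
  rw [sum_range_eq_add_Ico _ (by omega), Nat.cast_zero, chi_zero m a ha, zero_smul, zero_add]
  have : Icc 1 (8 * m + 4) = insert (8 * m + 4) (Ico 1 (8 * m + 4)) := by
    ext; simp only [mem_Icc, mem_insert, mem_Ico]; omega
  rw [this, sum_insert (by simp), ZMod.natCast_self, chi_zero m a ha, zero_smul, zero_add]

/-- The number `L(-p, χ)`, in terms of Bernoulli polynomials. -/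
noncomputable def lValue (m a p : ℕ) : ℂ :=
  -((8 * m + 4 : ℂ) ^ p / (p + 1)) * ∑ r ∈ Icc 1 (8 * m + 4), (chi m a r : ℂ) *
    (((Polynomial.bernoulli (p + 1)).eval ((r : ℚ) / (8 * m + 4)) : ℚ) : ℂ)

theorem LFunction_neg_nat (m a : ℕ) (ha : a < m) (p : ℕ) (hp : p ≠ 0) :
    ZMod.LFunction (fun r : ZMod (8 * m + 4) => (chi m a r : ℂ)) (-p) = lValue m a p := by
  have hz : ∀ r < 8 * m + 4, HurwitzZeta.hurwitzZeta (ZMod.toAddCircle (r : ZMod (8 * m + 4))) (-p)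
      = -1 / (p + 1) *
        (((Polynomial.bernoulli (p + 1)).eval ((r : ℚ) / (8 * m + 4)) : ℚ) : ℂ) := by
    intro r hr
    rw [ZMod.toAddCircle_apply, ZMod.val_natCast_of_lt hr, HurwitzZeta.hurwitzZeta_neg_nat hp]
    · congr 1
      have : (((r : ℝ) / ((8 * m + 4 : ℕ) : ℝ) : ℝ) : ℂ) =
          algebraMap ℚ ℂ ((r : ℚ) / (8 * m + 4)) := by
        push_cast; rfl
      rw [this, Polynomial.eval_map, Polynomial.eval₂_at_apply]
      rfl
    · constructor
      · positivity
      · rw [div_le_one (by positivity)]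
        exact_mod_cast hr.le
  have hs : ∑ j : ZMod (8 * m + 4), (chi m a j : ℂ) *
      HurwitzZeta.hurwitzZeta (ZMod.toAddCircle j) (-p) = ∑ r ∈ range (8 * m + 4),
      (chi m a (r : ZMod (8 * m + 4)) : ℂ) *
      HurwitzZeta.hurwitzZeta (ZMod.toAddCircle (r : ZMod (8 * m + 4))) (-p) := by
    refine sum_nbij' (fun j => j.val) (fun r => (r : ZMod (8 * m + 4))) ?_ ?_ ?_ ?_ ?_
    · exact fun j _ => mem_range.2 (ZMod.val_lt j)
    · simp
    · simp
    · exact fun r hr => ZMod.val_natCast_of_lt (mem_range.1 hr)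
    · simp
  have hI := sum_Icc_chi m a ha fun r =>
    (((Polynomial.bernoulli (p + 1)).eval ((r : ℚ) / (8 * m + 4)) : ℚ) : ℂ)
  simp only [zsmul_eq_mul] at hI
  rw [ZMod.LFunction, hs, lValue, hI, neg_neg, Complex.cpow_natCast]
  rw [sum_congr rfl fun r hr => by rw [hz r (mem_range.1 hr)]]
  rw [mul_sum, mul_sum]
  refine sum_congr rfl fun r _ => ?_
  push_cast
  ring

theorem TNumber_eq (m a : ℕ) (ha : a < m) (n : ℕ) :
    TNumber m a n = 1 / 2 * (-1) ^ (n + 1) * lValue m a (2 * n + 1) := by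
  rw [TNumber, ← LFunction_neg_nat m a ha _ (by omega)]
  congr 2
  push_cast
  ring

theorem TNumber_eq_bernoulli (m a : ℕ) (ha : a < m) (n : ℕ) : TNumber m a n =
      (-1) ^ n * 2 ^ (4 * n) * ((2 * m + 1) ^ (2 * n + 1) / (n + 1)) *
        ∑ r ∈ Finset.Icc 1 (8 * m + 4), (chi m a r : ℂ) *
          (((Polynomial.bernoulli (2 * n + 2)).eval ((r : ℚ) / (8 * m + 4)) : ℚ) : ℂ) := by
  rw [TNumber_eq m a ha, lValue, show 2 * n + 1 + 1 = 2 * n + 2 by ring,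
    show (8 * m + 4 : ℂ) = 4 * (2 * m + 1) by ring, ← mul_assoc]
  congr 1
  have h : (n + 1 : ℂ) ≠ 0 := by exact_mod_cast n.succ_ne_zero
  have h4 : (4 : ℂ) ^ (2 * n + 1) = 4 * 2 ^ (4 * n) := by
    rw [show (4 : ℂ) = 2 ^ 2 by norm_num, ← pow_mul, ← pow_add]; congr 1; ring
  rw [mul_pow, h4]
  push_cast
  rw [show (2 * n + 1 + 1 : ℂ) = 2 * (n + 1) by ring]
  field_simp
  ring

/-- The exponential generating function of the numbers `L(-p, χ)`. -/
noncomputable def lSeries (m a : ℕ) : ℂ⟦X⟧ := PowerSeries.mk fun p => lValue m a p / p.factorial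

theorem expMul_sub_one_ne_zero {c : ℂ} (hc : c ≠ 0) : expMul c - 1 ≠ 0 := by
  intro h
  have := congrArg (PowerSeries.coeff 1) h
  rw [map_sub, coeff_expMul, PowerSeries.coeff_one] at this
  simp at this
  exact hc this

/-- Heuristically the series is `∑ χ(n) e^{nt}`, summed geometrically over half-periods. The proof
uses the Bernoulli generating function instead. -/
theorem lSeries_mul (m a : ℕ) (ha : a < m) :
    lSeries m a * (1 + expMul (4 * m + 2 : ℂ)) =
      expMul (2 * m - 2 * a - 1 : ℂ) - expMul (2 * m + 2 * a + 3 : ℂ) := by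
  have hM : (8 * m + 4 : ℂ) ≠ 0 := by exact_mod_cast (show 8 * m + 4 ≠ 0 by omega)
  have gf : ∀ r : ℕ, (PowerSeries.mk fun n => (8 * m + 4 : ℂ) ^ n * ((1 / n.factorial : ℂ) *
      (((Polynomial.bernoulli n).eval ((r : ℚ) / (8 * m + 4)) : ℚ) : ℂ))) *
      (expMul (8 * m + 4 : ℂ) - 1) = PowerSeries.C (8 * m + 4 : ℂ) * PowerSeries.X *
      expMul (r : ℂ) := by
    intro r
    have h := congrArg (PowerSeries.rescale (8 * m + 4 : ℂ))
      (Polynomial.bernoulli_generating_function (A := ℂ) (algebraMap ℚ ℂ ((r : ℚ) / (8 * m + 4))))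
    rw [map_mul, map_mul, map_sub, map_one, PowerSeries.rescale_mk, PowerSeries.rescale_X] at h
    have h2 : PowerSeries.rescale (8 * m + 4 : ℂ) (PowerSeries.rescale
        (algebraMap ℚ ℂ ((r : ℚ) / (8 * m + 4))) (PowerSeries.exp ℂ)) = expMul (r : ℂ) := by
      rw [PowerSeries.rescale_rescale, expMul]
      congr 2
      simp only [eq_ratCast]
      push_cast
      field_simp
    rw [h2] at h
    rw [← h]
    congr 2
    ext n
    rw [Polynomial.aeval_algebraMap_apply]
    congr 1
    rw [map_smul, Polynomial.coe_aeval_eq_eval, smul_eq_mul, map_mul]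
    simp
  have hG : ∑ r ∈ range (8 * m + 4), chi m a (r : ZMod (8 * m + 4)) •
      (PowerSeries.mk fun n => (8 * m + 4 : ℂ) ^ n * ((1 / n.factorial : ℂ) *
      (((Polynomial.bernoulli n).eval ((r : ℚ) / (8 * m + 4)) : ℚ) : ℂ))) =
      -(PowerSeries.C (8 * m + 4 : ℂ) * PowerSeries.X * lSeries m a) := by
    ext n
    rw [map_sum, map_neg, mul_assoc, PowerSeries.coeff_C_mul]
    rcases n with _ | n
    -- In degree 0 the claim is that `χ` sums to zero over a period.
    · simp only [map_zsmul, PowerSeries.coeff_mk]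
      rw [sum_range_chi m a ha]
      simp
    · have hI := sum_Icc_chi m a ha fun r =>
        (((Polynomial.bernoulli (n + 1)).eval ((r : ℚ) / (8 * m + 4)) : ℚ) : ℂ)
      simp only [zsmul_eq_mul] at hI
      rw [PowerSeries.coeff_succ_X_mul, lSeries, PowerSeries.coeff_mk, lValue, hI]
      simp only [map_zsmul, PowerSeries.coeff_mk]
      simp only [zsmul_eq_mul]
      rw [mul_sum, sum_div, mul_sum, ← sum_neg_distrib]
      refine sum_congr rfl fun r _ => ?_
      rw [Nat.factorial_succ]
      have h1 : (n.factorial : ℂ) ≠ 0 := by exact_mod_cast n.factorial_ne_zero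
      have h2 : (n + 1 : ℂ) ≠ 0 := by exact_mod_cast n.succ_ne_zero
      push_cast
      field_simp
      ring
  have hS : (∑ r ∈ range (8 * m + 4), chi m a (r : ZMod (8 * m + 4)) •
      (PowerSeries.mk fun n => (8 * m + 4 : ℂ) ^ n * ((1 / n.factorial : ℂ) *
      (((Polynomial.bernoulli n).eval ((r : ℚ) / (8 * m + 4)) : ℚ) : ℂ)))) *
      (expMul (8 * m + 4 : ℂ) - 1) = PowerSeries.C (8 * m + 4 : ℂ) * PowerSeries.X *
      ((expMul (2 * m - 2 * a - 1 : ℂ) - expMul (2 * m + 2 * a + 3 : ℂ)) *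
        (1 - expMul (4 * m + 2 : ℂ))) := by
    rw [sum_mul]
    simp only [smul_mul_assoc, gf]
    rw [sum_range_chi m a ha (fun r => PowerSeries.C (8 * m + 4 : ℂ) * PowerSeries.X *
      expMul (r : ℂ))]
    simp only [mul_sub, sub_mul, expMul_mul, mul_one, mul_assoc]
    have e : ((2 * m - 2 * a - 1 : ℕ) : ℂ) = 2 * m - 2 * a - 1 := by
      rw [Nat.cast_sub (by omega), Nat.cast_sub (by omega)]; push_cast; rfl
    push_cast
    rw [e]
  -- With `E = e^{(4m+2)t}`, both sides contain `E - 1`, as `E² - 1 = (E - 1)(E + 1)`; it is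
  -- cancelled below.
  rw [hG, show (8 * m + 4 : ℂ) = (4 * m + 2) + (4 * m + 2) by ring, ← expMul_mul] at hS
  have hne : PowerSeries.C (4 * m + 2 + (4 * m + 2) : ℂ) * PowerSeries.X *
      (expMul (4 * m + 2 : ℂ) - 1) ≠ 0 := by
    refine mul_ne_zero (mul_ne_zero ?_ PowerSeries.X_ne_zero) (expMul_sub_one_ne_zero ?_)
    · rw [Ne, ← map_zero PowerSeries.C, PowerSeries.C_injective.eq_iff]
      intro h
      exact hM (by rw [← h]; ring)
    · exact_mod_cast (show 4 * m + 2 ≠ 0 by omega)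
  refine mul_left_cancel₀ hne ?_
  linear_combination -hS

theorem one_add_expMul_ne_zero (c : ℂ) : 1 + expMul c ≠ 0 := by
  intro h
  have := congrArg PowerSeries.constantCoeff h
  rw [map_add, constantCoeff_expMul] at this
  norm_num at this

/-- The two exponents in `lSeries_mul` add up to `4m + 2`, so the generating function is odd in `t`.
-/
theorem lValue_even (m a : ℕ) (ha : a < m) (i : ℕ) : lValue m a (2 * i) = 0 := by
  have h1 := lSeries_mul m a ha
  have h2 := congrArg (PowerSeries.rescale (-1 : ℂ)) h1
  simp only [map_mul, map_add, map_sub, map_one, rescale_expMul] at h2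
  have h3 : PowerSeries.rescale (-1 : ℂ) (lSeries m a) * (1 + expMul (4 * m + 2 : ℂ)) =
      expMul (2 * m + 2 * a + 3 : ℂ) - expMul (2 * m - 2 * a - 1 : ℂ) := by
    have := congrArg (· * expMul (4 * m + 2 : ℂ)) h2
    simp only [sub_mul, mul_assoc, add_mul, one_mul, expMul_mul] at this
    ring_nf at this ⊢
    simpa [add_comm] using this
  have h4 : PowerSeries.rescale (-1 : ℂ) (lSeries m a) + lSeries m a = 0 := by
    refine (mul_eq_zero.1 ?_).resolve_right (one_add_expMul_ne_zero (4 * m + 2 : ℂ))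
    rw [add_mul, h3, h1]; ring
  have h5 := congrArg (PowerSeries.coeff (2 * i)) h4
  rw [map_add, PowerSeries.coeff_rescale, lSeries, PowerSeries.coeff_mk, pow_mul] at h5
  have : ((2 * i).factorial : ℂ) ≠ 0 := by exact_mod_cast (2 * i).factorial_ne_zero
  norm_num at h5
  exact h5.resolve_right (Nat.factorial_ne_zero _)

/-- The functional `p ↦ "∑ n, χ(n) p(n)"` on polynomials, regularised by analytic continuation. -/
noncomputable def lFunctional (m a : ℕ) : Polynomial ℂ →ₗ[ℂ] ℂ :=
  Polynomial.lsum fun n => lValue m a n • LinearMap.id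

theorem lFunctional_monomial (m a n : ℕ) (c : ℂ) :
    lFunctional m a (Polynomial.monomial n c) = c * lValue m a n := by
  rw [lFunctional, Polynomial.lsum_apply, Polynomial.sum_monomial_index]
  · simp [mul_comm]
  · simp

theorem lFunctional_C_mul_X_pow (m a n : ℕ) (c : ℂ) :
    lFunctional m a (Polynomial.C c * Polynomial.X ^ n) = c * lValue m a n := by
  rw [Polynomial.C_mul_X_pow_eq_monomial, lFunctional_monomial]

/-- On monomials this is `lSeries_mul` read coefficientwise. It says that the regularised sum
respects antiperiodicity, leaving only the half-period boundary terms. -/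
theorem lFunctional_shift (m a : ℕ) (ha : a < m) (p : Polynomial ℂ) :
    lFunctional m a (p.comp (Polynomial.X + Polynomial.C (4 * m + 2 : ℂ))) + lFunctional m a p =
      p.eval (2 * m - 2 * a - 1 : ℂ) - p.eval (2 * m + 2 * a + 3 : ℂ) := by
  induction p using Polynomial.induction_on' with
  | add p q hp hq =>
    rw [Polynomial.add_comp, (lFunctional m a).map_add, (lFunctional m a).map_add,
      Polynomial.eval_add, Polynomial.eval_add]
    linear_combination hp + hq
  | monomial n c =>
    rw [lFunctional_monomial, Polynomial.monomial_comp, add_pow, mul_sum, map_sum,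
      Polynomial.eval_monomial, Polynomial.eval_monomial]
    have h := congrArg (PowerSeries.coeff n) (lSeries_mul m a ha)
    rw [mul_add, mul_one, map_add, map_sub, PowerSeries.coeff_mul,
      Nat.sum_antidiagonal_eq_sum_range_succ_mk] at h
    simp only [coeff_expMul, lSeries, PowerSeries.coeff_mk] at h
    have hn : (n.factorial : ℂ) ≠ 0 := by exact_mod_cast n.factorial_ne_zero
    have e : ∀ k ∈ range (n + 1), lFunctional m a (Polynomial.C c * (Polynomial.X ^ k *
        Polynomial.C (4 * m + 2 : ℂ) ^ (n - k) * (n.choose k : Polynomial ℂ))) =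
        c * n.factorial * (lValue m a k / k.factorial *
        ((algebraMap ℚ ℂ) (1 / (n - k).factorial) * (4 * m + 2) ^ (n - k))) := by
      intro k hk
      have hk' : k ≤ n := by have := mem_range.1 hk; omega
      rw [show Polynomial.C c * (Polynomial.X ^ k *
        Polynomial.C (4 * m + 2 : ℂ) ^ (n - k) * (n.choose k : Polynomial ℂ)) =
        Polynomial.C (c * (4 * m + 2) ^ (n - k) * n.choose k) * Polynomial.X ^ k by
        simp only [map_mul, map_pow, map_natCast]; ring]
      rw [lFunctional_C_mul_X_pow, Nat.cast_choose ℂ hk']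
      simp only [one_div, map_inv₀, map_natCast]
      ring
    rw [sum_congr rfl e, ← mul_sum]
    simp only [one_div, map_inv₀, map_natCast] at h ⊢
    have h' := congrArg (c * n.factorial * ·) h
    simp only [mul_add, mul_sub] at h'
    field_simp at h' ⊢
    linear_combination h'

end LValues

/-! ### The theta side at `q = e^{-t}`, `x = e^{Nt}` -/

section FormalIdentity

open Finset

section Maps

variable {R S : Type*} [CommRing R] [CommRing S] (f : R →+* S)

theorem map_qPoch (x q : R) (n : ℕ) : f (qPoch x q n) = qPoch (f x) (f q) n := by
  simp [qPoch, map_prod]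

theorem map_qBinom (q : R) (n c : ℕ) : f (qBinom q n c) = qBinom (f q) n c := by
  induction n generalizing c with
  | zero => cases c <;> simp [qBinom]
  | succ n ih =>
    cases c with
    | zero => simp
    | succ c => simp [qBinom_succ_succ, ih]

theorem map_iterate_baileyStep (q y : R) (u : ℕ → R) (b n : ℕ) :
    f ((baileyStep q y)^[b] u n) = (baileyStep (f q) (f y))^[b] (fun k => f (u k)) n := by
  induction b generalizing n with
  | zero => rfl
  | succ b ih =>
    rw [Function.iterate_succ_apply', Function.iterate_succ_apply', baileyStep, baileyStep, map_sum]
    simp [ih, map_qBinom]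

theorem map_innerSum (m b : ℕ) (q x : R) (n : ℕ) :
    f (innerSum m b q x n) = innerSum m b (f q) (f x) n := by
  rw [innerSum, innerSum, map_iterate_baileyStep]
  simp only [map_iterate_baileyStep, map_mul, map_pow, apply_ite f, map_one, map_zero]

/-- The terms of the theta series. -/
def thetaTerm (m b : ℕ) (q x : R) (j : ℕ) : R :=
  (-1) ^ j * q ^ (j + 1).choose 2 * x ^ j *
    (((x ^ 2) ^ j * q ^ j ^ 2) ^ b * (1 - (x ^ 2 * q ^ (2 * j + 1)) ^ b) *
    ((x ^ 2 * q) ^ j * q ^ j ^ 2) ^ (m - b))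

/-- Advancing the index amounts to replacing `x` by `x q`, that is `z` by `z - 1`. -/
theorem thetaTerm_succ (b d : ℕ) (q x : R) (j : ℕ) : thetaTerm (b + d) b q x (j + 1) =
    -(q ^ (b + 2 * d + 1) * x ^ (2 * (b + d) + 1)) * thetaTerm (b + d) b q (x * q) j := by
  rw [thetaTerm, thetaTerm, Nat.add_sub_cancel_left, Nat.choose_succ_succ' (j + 1) 1,
    Nat.choose_one_right,
    show (x * q) ^ 2 * q ^ (2 * j + 1) = x ^ 2 * q ^ (2 * (j + 1) + 1) by ring]
  generalize 1 - (x ^ 2 * q ^ (2 * (j + 1) + 1)) ^ b = A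
  simp only [← pow_mul, mul_pow, pow_add, pow_one, ← mul_assoc]
  ring

theorem sum_thetaTerm_succ (b d : ℕ) (q x : R) (N : ℕ) :
    ∑ j ∈ range (N + 1), thetaTerm (b + d) b q x j = 1 - (x ^ 2 * q) ^ b -
      q ^ (b + 2 * d + 1) * x ^ (2 * (b + d) + 1) *
        ∑ j ∈ range N, thetaTerm (b + d) b q (x * q) j := by
  rw [sum_range_succ', sum_congr rfl fun j _ => thetaTerm_succ b d q x j, ← mul_sum, thetaTerm]
  simp
  ring

end Maps

theorem expMul_neg_one_pow_ne_one (i : ℕ) : expMul (-1 : ℂ) ^ (i + 1) ≠ 1 := by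
  intro h
  rw [expMul_pow] at h
  exact expMul_sub_one_ne_zero (mul_ne_zero (Nat.cast_ne_zero.2 i.succ_ne_zero) (by norm_num))
    (sub_eq_zero.2 h)

theorem expMul_mul_pow (z : ℂ) (n : ℕ) : expMul z * expMul (-1) ^ n = expMul (z - n) := by
  rw [expMul_pow, expMul_mul]; congr 1; ring

theorem sum_innerSum_expMul (m b N : ℕ) :
    ∑ n ∈ range N, qPoch (expMul (N : ℂ)) (expMul (-1)) (n + 1) * expMul (N : ℂ) ^ n *
      innerSum m b (expMul (-1)) (expMul (N : ℂ)) n =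
    ∑ j ∈ range N, thetaTerm m b (expMul (-1)) (expMul (N : ℂ)) j := by
  -- The terminating identity was proved with denominators; its two sides have none, so it descends
  -- from the fraction field.
  let f := algebraMap ℂ⟦X⟧ (FractionRing ℂ⟦X⟧)
  have hf : Function.Injective f := IsFractionRing.injective ℂ⟦X⟧ (FractionRing ℂ⟦X⟧)
  apply hf
  have hq : ∀ i, f (expMul (-1)) ^ (i + 1) ≠ 1 := fun i h => by
    rw [← map_pow, ← map_one f] at h
    exact expMul_neg_one_pow_ne_one i (hf h)
  have hx : f (expMul (N : ℂ)) * f (expMul (-1)) ^ N = 1 := by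
    rw [← map_pow, ← map_mul, expMul_mul_pow, sub_self, expMul_zero, map_one]
  have := sum_qPoch_mul_innerSum hq hx m b
  simp only [map_sum, map_mul, map_qPoch, map_pow, map_innerSum, this]
  simp [thetaTerm]

/-- Coefficientwise application of `lFunctional`. -/
noncomputable def lApply (m a : ℕ) (G : (Polynomial ℂ)⟦X⟧) : ℂ⟦X⟧ :=
  PowerSeries.mk fun j => lFunctional m a (PowerSeries.coeff j G)

theorem lApply_map_C_mul (m a : ℕ) (u : ℂ⟦X⟧) (G : (Polynomial ℂ)⟦X⟧) :
    lApply m a (PowerSeries.map Polynomial.C u * G) = u * lApply m a G := by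
  ext j
  rw [lApply, PowerSeries.coeff_mk, PowerSeries.coeff_mul, PowerSeries.coeff_mul, map_sum]
  refine sum_congr rfl fun i _ => ?_
  rw [PowerSeries.coeff_map, ← Polynomial.smul_eq_C_mul, map_smul, lApply, PowerSeries.coeff_mk,
    smul_eq_mul]

theorem lApply_shift (m a : ℕ) (ha : a < m) (G : (Polynomial ℂ)⟦X⟧) :
    lApply m a (PowerSeries.map
      (Polynomial.compRingHom (Polynomial.X + Polynomial.C (4 * m + 2 : ℂ))) G) + lApply m a G =
    PowerSeries.map (Polynomial.evalRingHom (2 * m - 2 * a - 1 : ℂ)) G -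
    PowerSeries.map (Polynomial.evalRingHom (2 * m + 2 * a + 3 : ℂ)) G := by
  ext j
  simp only [map_add, map_sub, lApply, PowerSeries.coeff_mk, PowerSeries.coeff_map,
    Polynomial.coe_evalRingHom, Polynomial.coe_compRingHom_apply]
  have := lFunctional_shift m a ha (PowerSeries.coeff j G)
  rw [Polynomial.C_add] at this
  exact this

/-- `e^{(z n / 2 - n² / (8 (2 m + 1))) t}` as a power series in `t` over the polynomials in `n`. -/
noncomputable def gaussSeries (m : ℕ) (z : ℂ) : (Polynomial ℂ)⟦X⟧ :=
  expMul (Polynomial.C (-(1 / (8 * (2 * m + 1)) : ℂ)) * Polynomial.X ^ 2 +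
    Polynomial.C (z / 2) * Polynomial.X)

/-- The regularised theta series at `x = e^{z t}`, `q = e^{-t}`. -/
noncomputable def thetaSeries (m a : ℕ) (z : ℂ) : ℂ⟦X⟧ :=
  expMul ((2 * m - 2 * a - 1) ^ 2 / (8 * (2 * m + 1)) - (2 * m - 2 * a - 1) * z / 2) *
    lApply m a (gaussSeries m z)

/-- Translating `n` by `4m + 2` in `z n / 2 - n² / (8(2m+1))` changes the linear term by `-n / 2`,
so `z` drops by 1. -/
theorem map_comp_gaussSeries (m : ℕ) (z : ℂ) : PowerSeries.map
    (Polynomial.compRingHom (Polynomial.X + Polynomial.C (4 * m + 2 : ℂ))) (gaussSeries m z) =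
    PowerSeries.map Polynomial.C (expMul ((2 * m + 1) * z - (2 * m + 1) / 2 : ℂ)) *
      gaussSeries m (z - 1) := by
  rw [gaussSeries, gaussSeries, map_expMul, map_expMul, expMul_mul]
  congr 1
  have h : (2 * m + 1 : ℂ) ≠ 0 := by exact_mod_cast (show 2 * m + 1 ≠ 0 by omega)
  simp only [Polynomial.coe_compRingHom_apply, Polynomial.add_comp, Polynomial.mul_comp,
    Polynomial.C_comp, Polynomial.pow_comp, Polynomial.X_comp]
  have h1 : Polynomial.C (-(1 / (8 * (2 * m + 1)) : ℂ)) * Polynomial.C (4 * m + 2 : ℂ) * 2 =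
      Polynomial.C (-(1 / 2) : ℂ) := by
    rw [show (2 : Polynomial ℂ) = Polynomial.C 2 by rw [map_ofNat], ← Polynomial.C_mul,
      ← Polynomial.C_mul]
    congr 1; field_simp; ring
  have h2 : Polynomial.C (-(1 / (8 * (2 * m + 1)) : ℂ)) * Polynomial.C (4 * m + 2 : ℂ) ^ 2 +
      Polynomial.C (z / 2) * Polynomial.C (4 * m + 2 : ℂ) =
      Polynomial.C ((2 * m + 1) * z - (2 * m + 1) / 2 : ℂ) := by
    rw [← Polynomial.C_pow, ← Polynomial.C_mul, ← Polynomial.C_mul, ← Polynomial.C_add]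
    congr 1; field_simp; ring
  have h3 : Polynomial.C ((z - 1) / 2) = Polynomial.C (z / 2) + Polynomial.C (-(1 / 2) : ℂ) := by
    rw [← Polynomial.C_add]; congr 1; ring
  rw [← h2, h3, ← h1]
  ring

theorem map_eval_gaussSeries (m : ℕ) (z c : ℂ) :
    PowerSeries.map (Polynomial.evalRingHom c) (gaussSeries m z) =
      expMul (-(1 / (8 * (2 * m + 1))) * c ^ 2 + z / 2 * c) := by
  rw [gaussSeries, map_expMul]
  simp only [Polynomial.coe_evalRingHom, Polynomial.eval_add, Polynomial.eval_mul,
    Polynomial.eval_C, Polynomial.eval_pow, Polynomial.eval_X]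

theorem thetaSeries_succ (b d : ℕ) (z : ℂ) :
    thetaSeries (b + 1 + d) b z = 1 - (expMul z ^ 2 * expMul (-1)) ^ (b + 1) -
      expMul (-1) ^ (b + 1 + 2 * d + 1) * expMul z ^ (2 * (b + 1 + d) + 1) *
        thetaSeries (b + 1 + d) b (z - 1) := by
  have h := lApply_shift (b + 1 + d) b (by omega) (gaussSeries (b + 1 + d) z)
  rw [map_comp_gaussSeries, lApply_map_C_mul] at h
  simp only [map_eval_gaussSeries] at h
  have hm : (2 * ((b + 1 + d : ℕ) : ℂ) + 1) ≠ 0 := by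
    exact_mod_cast (show 2 * (b + 1 + d) + 1 ≠ 0 by omega)
  -- The prefactor in `thetaSeries` normalises the boundary term at `2m - 2a - 1` to 1.
  rw [thetaSeries, thetaSeries, eq_sub_of_add_eq' h]
  simp only [mul_sub, expMul_pow, ← mul_assoc, expMul_mul]
  congr 1
  · congr 1
    · rw [← expMul_zero]
      congr 1
      field_simp
      ring
    · congr 1
      push_cast at hm ⊢
      field_simp
      ring
  · congr 2
    push_cast at hm ⊢
    field_simp
    ring

theorem coeff_lApply_gaussSeries (m a : ℕ) (z : ℂ) (j : ℕ) :
    PowerSeries.coeff j (lApply m a (gaussSeries m z)) = (1 / j.factorial) *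
      ∑ k ∈ range (j + 1), (-(1 / (8 * (2 * m + 1)) : ℂ)) ^ k * (z / 2) ^ (j - k) *
        j.choose k * lValue m a (j + k) := by
  rw [lApply, PowerSeries.coeff_mk, gaussSeries, coeff_expMul, add_pow, mul_sum, map_sum, mul_sum]
  refine sum_congr rfl fun k hk => ?_
  have hk' : k ≤ j := by have := mem_range.1 hk; omega
  obtain ⟨i, rfl⟩ := Nat.exists_eq_add_of_le hk'
  rw [Nat.add_sub_cancel_left, show (algebraMap ℚ (Polynomial ℂ)) (1 / (k + i).factorial) *
    ((Polynomial.C (-(1 / (8 * (2 * m + 1)) : ℂ)) * Polynomial.X ^ 2) ^ k *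
    (Polynomial.C (z / 2) * Polynomial.X) ^ i * ((k + i).choose k : Polynomial ℂ)) =
    Polynomial.C ((1 / (k + i).factorial) * ((-(1 / (8 * (2 * m + 1)) : ℂ)) ^ k * (z / 2) ^ i *
    (k + i).choose k)) * Polynomial.X ^ (k + i + k) by
      have : (algebraMap ℚ (Polynomial ℂ)) (1 / (k + i).factorial) =
        Polynomial.C (1 / (k + i).factorial : ℂ) := by
        rw [← Polynomial.C.map_rat_algebraMap]; simp
      rw [this]
      simp only [Polynomial.C_mul, Polynomial.C_pow, Polynomial.C_eq_natCast]
      ring]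
  rw [lFunctional_C_mul_X_pow]
  ring

/-- At `z = 0` only even powers of `n` occur. This starts the induction on `N` and later removes the
derivative of the prefactor. -/
theorem lApply_gaussSeries_zero (m a : ℕ) (ha : a < m) : lApply m a (gaussSeries m 0) = 0 := by
  ext j
  rw [coeff_lApply_gaussSeries, sum_eq_single j]
  · rw [← two_mul, lValue_even m a ha]; simp
  · intro k hk hkj
    have : j - k ≠ 0 := by have := mem_range.1 hk; omega
    simp [this]
  · simp

theorem sum_thetaTerm_eq_thetaSeries (b d N : ℕ) :
    ∑ j ∈ range N, thetaTerm (b + 1 + d) (b + 1) (expMul (-1)) (expMul (N : ℂ)) j =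
      thetaSeries (b + 1 + d) b N := by
  induction N with
  | zero => simp [thetaSeries, lApply_gaussSeries_zero _ _ (show b < b + 1 + d by omega)]
  | succ N ih =>
    rw [sum_thetaTerm_succ, thetaSeries_succ, show ((N + 1 : ℕ) : ℂ) - 1 = N by push_cast; ring,
      ← ih, expMul_mul, show ((N + 1 : ℕ) : ℂ) + -1 = N by push_cast; ring]

end FormalIdentity

/-! ### From natural `z` to formal `z`, and the part linear in `z` -/

section Interpolation

open Finset

theorem X_pow_dvd_qPoch {R : Type*} [CommRing R] {x q : R⟦X⟧}
    (hx : PowerSeries.constantCoeff x = 1) (hq : PowerSeries.constantCoeff q = 1) (n : ℕ) :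
    PowerSeries.X ^ n ∣ qPoch x q n := by
  induction n with
  | zero => simp
  | succ n ih =>
    rw [pow_succ, qPoch_succ]
    refine mul_dvd_mul ih (PowerSeries.X_dvd_iff.2 ?_)
    simp [hx, hq]

theorem coeff_eq_of_X_pow_dvd_sub {R : Type*} [CommRing R] {f g : R⟦X⟧} {J j : ℕ}
    (h : PowerSeries.X ^ J ∣ f - g) (hj : j < J) :
    PowerSeries.coeff j f = PowerSeries.coeff j g :=
  sub_eq_zero.1 (by rw [← map_sub]; exact PowerSeries.X_pow_dvd_iff.1 h j hj)

/-- A truncation of `∑_n (x q)_n x^n c_n(x)`. -/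
def truncSum {R : Type*} [CommRing R] (m b : ℕ) (q x : R) (J : ℕ) : R :=
  ∑ n ∈ range J, qPoch (x * q) q n * x ^ n * innerSum m b q x n

theorem one_sub_mul_truncSum {R : Type*} [CommRing R] (m b : ℕ) (q x : R) (J : ℕ) :
    (1 - x) * truncSum m b q x J =
      ∑ n ∈ range J, qPoch x q (n + 1) * x ^ n * innerSum m b q x n := by
  rw [truncSum, mul_sum]
  refine sum_congr rfl fun n _ => ?_
  rw [qPoch_succ']; ring

theorem map_truncSum {R S : Type*} [CommRing R] [CommRing S] (f : R →+* S) (m b : ℕ) (q x : R)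
    (J : ℕ) : f (truncSum m b q x J) = truncSum m b (f q) (f x) J := by
  simp [truncSum, map_qPoch, map_innerSum]

theorem X_pow_dvd_truncSum_sub (m b : ℕ) (z : ℂ) {J J' : ℕ} (h : J ≤ J') :
    PowerSeries.X ^ J ∣ truncSum m b (expMul (-1)) (expMul z) J' -
      truncSum m b (expMul (-1)) (expMul z) J := by
  rw [truncSum, truncSum, ← sum_sdiff_eq_sub (range_mono h)]
  refine dvd_sum fun n hn => ?_
  have hn : J ≤ n := by simp only [mem_sdiff, mem_range] at hn; omega
  refine ((pow_dvd_pow _ hn).trans (X_pow_dvd_qPoch ?_ ?_ n)).mul_right _ |>.mul_right _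
  · rw [map_mul, constantCoeff_expMul, constantCoeff_expMul, one_mul]
  · exact constantCoeff_expMul _

theorem qPoch_expMul_natCast (N n : ℕ) (h : N ≤ n) :
    qPoch (expMul (N : ℂ)) (expMul (-1)) (n + 1) = 0 := by
  rw [qPoch]
  refine prod_eq_zero (mem_range.2 (show N < n + 1 by omega)) ?_
  rw [expMul_mul_pow, sub_self, expMul_zero, sub_self]

/-- If `J ≤ N`, the omitted terms are divisible by `t^J`; if `N ≤ J`, the additional ones vanish
because `(q^{-N})_{n+1} = 0` for `n ≥ N`. -/
theorem coeff_truncSum_natCast (b d N j J : ℕ) (hj : j < J) :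
    PowerSeries.coeff j ((1 - expMul (N : ℂ)) *
      truncSum (b + 1 + d) (b + 1) (expMul (-1)) (expMul (N : ℂ)) J) =
    PowerSeries.coeff j (thetaSeries (b + 1 + d) b N) := by
  rw [← sum_thetaTerm_eq_thetaSeries, ← sum_innerSum_expMul, ← one_sub_mul_truncSum]
  rcases le_total J N with h | h
  · refine (coeff_eq_of_X_pow_dvd_sub ?_ hj).symm
    rw [← mul_sub]
    exact (X_pow_dvd_truncSum_sub _ _ _ h).mul_left _
  · rw [one_sub_mul_truncSum, one_sub_mul_truncSum, sum_subset (range_mono h)]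
    intro n _ hn
    rw [qPoch_expMul_natCast N n (by simpa using hn), zero_mul, zero_mul]

/-- The series `lApply m a (gaussSeries m z)` with a formal `z`. -/
noncomputable def gaussPoly (m a : ℕ) : (Polynomial ℂ)⟦X⟧ :=
  PowerSeries.mk fun j => ∑ k ∈ range (j + 1),
    Polynomial.C ((1 / j.factorial) * (-(1 / (8 * (2 * m + 1)) : ℂ)) ^ k * (1 / 2) ^ (j - k) *
      j.choose k * lValue m a (j + k)) * Polynomial.X ^ (j - k)

/-- The series `thetaSeries m a z` with a formal `z`. -/
noncomputable def thetaPoly (m a : ℕ) : (Polynomial ℂ)⟦X⟧ :=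
  PowerSeries.map Polynomial.C (expMul ((2 * m - 2 * a - 1) ^ 2 / (8 * (2 * m + 1)) : ℂ)) *
    expMul (Polynomial.C (-(2 * m - 2 * a - 1) / 2 : ℂ) * Polynomial.X) * gaussPoly m a

theorem map_eval_gaussPoly (m a : ℕ) (z : ℂ) :
    PowerSeries.map (Polynomial.evalRingHom z) (gaussPoly m a) = lApply m a (gaussSeries m z) := by
  ext j
  rw [coeff_lApply_gaussSeries, PowerSeries.coeff_map, gaussPoly, PowerSeries.coeff_mk, map_sum,
    mul_sum]
  refine sum_congr rfl fun k _ => ?_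
  simp only [Polynomial.coe_evalRingHom, Polynomial.eval_mul, Polynomial.eval_C,
    Polynomial.eval_pow, Polynomial.eval_X]
  ring

theorem map_eval_thetaPoly (m a : ℕ) (z : ℂ) :
    PowerSeries.map (Polynomial.evalRingHom z) (thetaPoly m a) = thetaSeries m a z := by
  rw [thetaPoly, thetaSeries, map_mul, map_mul, map_eval_gaussPoly, map_expMul, map_expMul,
    map_expMul, expMul_mul]
  congr 2
  simp
  ring

/-- Both coefficients are polynomials in `z` that agree at every natural number. -/
theorem coeff_truncSum_formal (b d j J : ℕ) (hj : j < J) :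
    PowerSeries.coeff j ((1 - expMul (Polynomial.X : Polynomial ℂ)) *
      truncSum (b + 1 + d) (b + 1) (expMul (-1)) (expMul (Polynomial.X : Polynomial ℂ)) J) =
    PowerSeries.coeff j (thetaPoly (b + 1 + d) b) := by
  refine Polynomial.eq_of_infinite_eval_eq _ _
    ((Set.infinite_range_of_injective (Nat.cast_injective (R := ℂ))).mono ?_)
  rintro _ ⟨N, rfl⟩
  have h := coeff_truncSum_natCast b d N j J hj
  rw [← map_eval_thetaPoly, PowerSeries.coeff_map, Polynomial.coe_evalRingHom] at h
  rw [Set.mem_ofPred_eq, ← h, ← Polynomial.coe_evalRingHom, ← PowerSeries.coeff_map, map_mul,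
    map_truncSum, map_sub, map_one, map_expMul, map_expMul]
  simp

/-- The coefficient of the first power of the variable of the coefficient ring. -/
noncomputable def linearPart (f : (Polynomial ℂ)⟦X⟧) : ℂ⟦X⟧ :=
  PowerSeries.mk fun j => (PowerSeries.coeff j f).coeff 1

theorem linearPart_mul (f g : (Polynomial ℂ)⟦X⟧) : linearPart (f * g) =
    PowerSeries.map (Polynomial.evalRingHom 0) f * linearPart g +
      linearPart f * PowerSeries.map (Polynomial.evalRingHom 0) g := by
  ext j
  simp only [linearPart, map_add, PowerSeries.coeff_mul, PowerSeries.coeff_mk,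
    PowerSeries.coeff_map, Polynomial.finsetSum_coeff, ← sum_add_distrib,
    Polynomial.coe_evalRingHom, ← Polynomial.coeff_zero_eq_eval_zero]
  refine sum_congr rfl fun x _ => ?_
  rw [Polynomial.mul_coeff_one]

theorem linearPart_one_sub_expMul :
    linearPart (1 - expMul (Polynomial.X : Polynomial ℂ)) = -PowerSeries.X := by
  ext j
  have : (algebraMap ℚ (Polynomial ℂ)) (1 / j.factorial) =
      Polynomial.C (1 / j.factorial : ℂ) := by
    rw [← Polynomial.C.map_rat_algebraMap]; simp
  rw [linearPart, PowerSeries.coeff_mk, map_sub, coeff_expMul, this, Polynomial.coeff_sub,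
    Polynomial.coeff_C_mul, Polynomial.coeff_X_pow, PowerSeries.coeff_one, map_neg,
    PowerSeries.coeff_X]
  rcases eq_or_ne j 1 with rfl | h1
  · simp
  · rw [if_neg (Ne.symm h1), if_neg h1]
    split_ifs <;> simp [Polynomial.coeff_one]

theorem linearPart_gaussPoly (m a : ℕ) (ha : a < m) : linearPart (gaussPoly m a) =
    PowerSeries.X * PowerSeries.mk fun i => -(TNumber m a i / i.factorial *
      (1 / (8 * (2 * m + 1))) ^ i) := by
  ext j
  rw [linearPart, PowerSeries.coeff_mk, gaussPoly, PowerSeries.coeff_mk,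
    Polynomial.finsetSum_coeff]
  rcases j with _ | j
  · simp [Polynomial.coeff_one]
  -- In degree `j + 1` the first power of `z` occurs only at `k = j`, with L-value index `2j + 1`.
  rw [PowerSeries.coeff_succ_X_mul, PowerSeries.coeff_mk, sum_eq_single j]
  · rw [show j + 1 - j = 1 by omega, Polynomial.coeff_C_mul, pow_one, pow_one, Polynomial.coeff_X_one,
      TNumber_eq m a ha, Nat.choose_succ_self_right, Nat.factorial_succ,
      show j + 1 + j = 2 * j + 1 by ring]
    have h1 : (j.factorial : ℂ) ≠ 0 := by exact_mod_cast j.factorial_ne_zero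
    have h2 : (j + 1 : ℂ) ≠ 0 := by exact_mod_cast j.succ_ne_zero
    rw [neg_pow (1 / (8 * (2 * m + 1)) : ℂ)]
    push_cast
    generalize (1 / (8 * (2 * m + 1)) : ℂ) ^ j = A
    field_simp
    ring
  · intro k hk hkj
    rw [Polynomial.coeff_C_mul, Polynomial.coeff_X_pow, if_neg, mul_zero]
    have := mem_range.1 hk
    omega
  · simp

theorem linearPart_thetaPoly (m a : ℕ) (ha : a < m) : linearPart (thetaPoly m a) =
    -(PowerSeries.X * (expSeries ((2 * m - 2 * a - 1) ^ 2 / (8 * (2 * m + 1))) *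
        PowerSeries.mk (fun n : ℕ =>
          TNumber m a n / (n.factorial : ℂ) * (1 / (8 * (2 * m + 1))) ^ n))) := by
  have h0 : PowerSeries.map (Polynomial.evalRingHom 0) (gaussPoly m a) = 0 := by
    rw [map_eval_gaussPoly, lApply_gaussSeries_zero m a ha]
  rw [thetaPoly, linearPart_mul, h0, mul_zero, add_zero, linearPart_gaussPoly m a ha, map_mul,
    map_expMul, map_expMul, map_expMul, expSeries_eq]
  simp only [Polynomial.coe_evalRingHom, Polynomial.eval_mul, Polynomial.eval_C,
    Polynomial.eval_X, mul_zero, expMul_zero, mul_one]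
  have : (PowerSeries.mk fun i => -(TNumber m a i / i.factorial *
      (1 / (8 * (2 * m + 1))) ^ i)) = -PowerSeries.mk (fun i => TNumber m a i / i.factorial *
      (1 / (8 * (2 * m + 1))) ^ i) := by
    ext i; simp
  rw [this]
  ring

/-- As `1 - e^{zt}` vanishes at `z = 0` with linear part `-t`, only the value of the truncated sum
at `x = 1` survives. The factor `t` accounts for `j + 1` in the hypothesis. -/
theorem coeff_truncSum_one (b d j J : ℕ) (hj : j + 1 < J) :
    PowerSeries.coeff j (truncSum (b + 1 + d) (b + 1) (expMul (-1 : ℂ)) 1 J) =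
    PowerSeries.coeff j (expSeries ((2 * (b + 1 + d : ℕ) - 2 * b - 1) ^ 2 /
      (8 * (2 * (b + 1 + d : ℕ) + 1))) * PowerSeries.mk (fun n : ℕ =>
        TNumber (b + 1 + d) b n / (n.factorial : ℂ) *
          (1 / (8 * (2 * (b + 1 + d : ℕ) + 1))) ^ n)) := by
  have h := congrArg (fun p => Polynomial.coeff p 1) (coeff_truncSum_formal b d (j + 1) J hj)
  have e : ∀ f, (PowerSeries.coeff (j + 1) f).coeff 1 = PowerSeries.coeff (j + 1) (linearPart f) :=
    fun f => by rw [linearPart, PowerSeries.coeff_mk]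
  simp only [e] at h
  rw [linearPart_thetaPoly _ _ (by omega), linearPart_mul, linearPart_one_sub_expMul, map_sub,
    map_one, map_expMul, Polynomial.coe_evalRingHom, Polynomial.eval_X, expMul_zero, sub_self,
    zero_mul, zero_add, map_truncSum, map_expMul, map_expMul, map_neg, map_neg,
    PowerSeries.coeff_succ_X_mul, neg_mul, map_neg, PowerSeries.coeff_succ_X_mul, neg_inj] at h
  simpa using h

end Interpolation

/-! ### The multisum as an iterated Bailey step -/

section MultiSum

open Finset

section ChainSum

variable {R : Type*} [CommRing R]

/-- The sum over `k_1, …, k_i < B` of the products `∏_{l ≤ i} W_l(k_l, k_{l+1})`, where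
`k_{i+1} = n`. -/
def chainSum (W : ℕ → ℕ → ℕ → R) (B : ℕ) : ℕ → ℕ → R
  | 0, _ => 1
  | i + 1, n => ∑ k ∈ range B, W (i + 1) k n * chainSum W B i k

theorem sum_piFinset_succ {s : ℕ} (B : ℕ) (f : (Fin (s + 1) → ℕ) → R) :
    ∑ k ∈ Fintype.piFinset (fun _ : Fin (s + 1) => range B), f k =
      ∑ n ∈ range B, ∑ k ∈ Fintype.piFinset (fun _ : Fin s => range B),
        f (Fin.snoc (α := fun _ => ℕ) k n) := by
  rw [sum_sigma']
  refine sum_bij' (fun k _ => ⟨k (Fin.last s), fun i => k i.castSucc⟩)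
    (fun p _ => Fin.snoc (α := fun _ => ℕ) p.2 p.1) ?_ ?_ ?_ ?_ ?_
  · intro k hk
    rw [Fintype.mem_piFinset] at hk
    simp only [mem_sigma, Fintype.mem_piFinset]
    exact ⟨hk _, fun i => hk _⟩
  · intro p hp
    simp only [mem_sigma, Fintype.mem_piFinset] at hp
    rw [Fintype.mem_piFinset]
    intro i
    refine Fin.lastCases ?_ (fun i => ?_) i
    · simpa using hp.1
    · simpa using hp.2 i
  · intro k _
    exact Fin.snoc_init_self k
  · intro p _
    simp
  · intro k _
    congr 1
    exact (Fin.snoc_init_self k).symm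

theorem sum_piFinset_chain (W : ℕ → ℕ → ℕ → R) (B s : ℕ) (φ : ℕ → R) :
    ∑ k ∈ Fintype.piFinset (fun _ : Fin (s + 1) => range B),
      φ (k (Fin.last s)) * ∏ i : Fin s, W (i + 1) (k i.castSucc) (k i.succ) =
    ∑ n ∈ range B, φ n * chainSum W B s n := by
  induction s generalizing φ with
  | zero =>
    rw [sum_piFinset_succ]
    refine sum_congr rfl fun n _ => ?_
    simp [chainSum, Fin.snoc]
  | succ s ih =>
    rw [sum_piFinset_succ]
    refine sum_congr rfl fun n _ => ?_
    rw [chainSum, ← ih fun k => W (s + 1) k n, mul_sum]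
    refine sum_congr rfl fun k _ => ?_
    rw [Fin.prod_univ_castSucc]
    simp only [Fin.snoc_last, Fin.snoc_castSucc, Fin.succ_last, Fin.succ_castSucc,
      Fin.val_castSucc, Fin.val_last]
    ring

/-- The weight joining `k_i = k` and `k_{i+1} = n` in the summand `XTerm m a q`. -/
def linkWeight (a : ℕ) (q : R) (i k n : ℕ) : R :=
  qBinom q (n + if i = a then 1 else 0) k * q ^ (k ^ 2 + if a + 1 ≤ i then k else 0)

theorem kIdx_succ {m : ℕ} (k : Fin m → ℕ) (i : ℕ) (h : i < m) : kIdx k (i + 1) = k ⟨i, h⟩ := by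
  rw [kIdx, dif_pos ⟨by omega, by omega⟩]; rfl

theorem XTerm_eq_prod_Ico (m a : ℕ) (ha : a < m) (q : R) (k : Fin m → ℕ) :
    XTerm m a q k = qPoch q q (kIdx k m) *
      ∏ i ∈ Ico 1 m, linkWeight a q i (kIdx k i) (kIdx k (i + 1)) := by
  simp only [linkWeight, prod_mul_distrib, prod_pow_eq_pow_sum, sum_add_distrib]
  rw [XTerm, ← sum_filter, show (Ico 1 m).filter (fun i => a + 1 ≤ i) = Ico (a + 1) m by
    ext; simp only [mem_filter, mem_Ico]; omega]
  have h : ∏ i ∈ (Ico 1 m).erase a, qBinom q (kIdx k (i + 1)) (kIdx k i) =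
      ∏ i ∈ (Ico 1 m).erase a, qBinom q (kIdx k (i + 1) + if i = a then 1 else 0) (kIdx k i) :=
    prod_congr rfl fun i hi => by rw [if_neg (ne_of_mem_erase hi), add_zero]
  rw [h]
  rcases Nat.eq_zero_or_pos a with rfl | h0
  · rw [erase_eq_of_notMem (by simp), show kIdx k 0 = 0 by simp [kIdx], qBinom_zero_right]
    ring
  · rw [← mul_prod_erase (Ico 1 m) _ (mem_Ico.2 ⟨h0, ha⟩), if_pos rfl]
    ring

theorem XTerm_eq_prod (s a : ℕ) (ha : a < s + 1) (q : R) (k : Fin (s + 1) → ℕ) :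
    XTerm (s + 1) a q k = qPoch q q (k (Fin.last s)) *
      ∏ i : Fin s, linkWeight a q (i + 1) (k i.castSucc) (k i.succ) := by
  rw [XTerm_eq_prod_Ico _ _ ha, prod_Ico_eq_prod_range, kIdx_succ k s (by omega),
    Nat.add_sub_cancel, prod_range]
  congr 1
  refine prod_congr rfl fun i _ => ?_
  rw [add_comm 1, kIdx_succ k i (by omega), kIdx_succ k (i + 1) (by omega)]
  rfl

theorem sum_range_eq_baileyStep (q y : R) (u : ℕ → R) (n B : ℕ) (h : n < B) :
    ∑ k ∈ range B, qBinom q n k * (y ^ k * q ^ k ^ 2) * u k = baileyStep q y u n := by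
  rw [baileyStep]
  refine (sum_subset (range_mono (show n + 1 ≤ B by omega)) fun k _ hk => ?_).symm
  rw [qBinom_eq_zero _ _ _ (by simpa using hk), zero_mul, zero_mul]

theorem baileyStep_unit (q y : R) (n : ℕ) :
    baileyStep q y (fun k => if k = 0 then 1 else 0) n = 1 := by
  simp [baileyStep]

theorem chainSum_linkWeight_of_lt (a : ℕ) (q : R) (B i n : ℕ) (hi : i < a) (h : n + i < B) :
    chainSum (linkWeight a q) B i n =
      (baileyStep q 1)^[i + 1] (fun k => if k = 0 then 1 else 0) n := by
  induction i generalizing n with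
  | zero => rw [chainSum, zero_add, Function.iterate_one, baileyStep_unit]
  | succ i ih =>
    rw [chainSum, Function.iterate_succ_apply', ← sum_range_eq_baileyStep q 1 _ n B (by omega)]
    refine sum_congr rfl fun k _ => ?_
    rw [linkWeight, if_neg (by omega), if_neg (by omega), add_zero, add_zero, one_pow, one_mul]
    rcases le_or_gt k n with hk | hk
    · rw [ih k (by omega) (by omega)]
    · rw [qBinom_eq_zero _ _ _ hk, zero_mul, zero_mul, zero_mul]

/-- Links up to `a` are steps with `y = 1`, later ones carry an extra `q^k` and have `y = q`, and
the raised q-binomial at link `a` evaluates the first block at `n + 1`. The step beyond the number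
of links is the one taking the unit sequence to the constant 1. -/
theorem chainSum_linkWeight (a : ℕ) (q : R) (B i n : ℕ) (h : n + a + i + 1 < B) :
    chainSum (linkWeight a q) B (a + i) n =
      (baileyStep q q)^[i]
        (fun n => (baileyStep q 1)^[a + 1] (fun k => if k = 0 then 1 else 0) (n + 1)) n := by
  induction i generalizing n with
  | zero =>
    rcases a with _ | a
    · simp [chainSum, baileyStep_unit]
    · rw [add_zero, chainSum, Function.iterate_zero_apply, Function.iterate_succ_apply',
        ← sum_range_eq_baileyStep q 1 _ (n + 1) B (by omega)]
      refine sum_congr rfl fun k _ => ?_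
      rw [linkWeight, if_pos rfl, if_neg (by omega), add_zero, one_pow, one_mul]
      rcases le_or_gt k (n + 1) with hk | hk
      · rw [chainSum_linkWeight_of_lt _ _ _ _ _ (by omega) (by omega)]
      · rw [qBinom_eq_zero _ _ _ hk, zero_mul, zero_mul, zero_mul]
  | succ i ih =>
    rw [← add_assoc, chainSum, Function.iterate_succ_apply',
      ← sum_range_eq_baileyStep q q _ n B (by omega)]
    refine sum_congr rfl fun k _ => ?_
    rw [linkWeight, if_neg (by omega), if_pos (by omega), add_zero, pow_add, mul_comm (q ^ k ^ 2)]
    rcases le_or_gt k n with hk | hk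
    · rw [ih k (by omega)]
    · rw [qBinom_eq_zero _ _ _ hk, zero_mul, zero_mul, zero_mul]

theorem chainSum_eq_innerSum (b d : ℕ) (q : R) (B n : ℕ) (h : n + b + d + 1 < B) :
    chainSum (linkWeight b q) B (b + d) n = innerSum (b + 1 + d) (b + 1) q 1 n := by
  rw [chainSum_linkWeight b q B d n h, innerSum, Nat.add_sub_cancel_left, one_pow, one_mul]

end ChainSum

/-- The factor `(q)_{k_m}` is divisible by `t^{k_m}`, so `k_m ≤ j`, and nonvanishing q-binomials
allow `k_i` to exceed `k_{i+1}` by at most 1. -/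
theorem coeff_XTerm_ne_zero_bound (s a : ℕ) (ha : a < s + 1) (j : ℕ) (k : Fin (s + 1) → ℕ)
    (h : PowerSeries.coeff j (XTerm (s + 1) a (expSeries (-1)) k) ≠ 0) (i : Fin (s + 1)) :
    k i ≤ j + s := by
  rw [XTerm_eq_prod s a ha, expSeries_eq] at h
  have hlast : k (Fin.last s) ≤ j := by
    by_contra hk
    push Not at hk
    exact h (PowerSeries.X_pow_dvd_iff.1 ((X_pow_dvd_qPoch (constantCoeff_expMul _)
      (constantCoeff_expMul _) _).mul_right _) j hk)
  have hstep : ∀ i : Fin s, k i.castSucc ≤ k i.succ + 1 := by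
    intro i
    by_contra hk
    push Not at hk
    apply h
    rw [prod_eq_zero (mem_univ i), mul_zero, map_zero]
    rw [linkWeight, qBinom_eq_zero, zero_mul]
    split_ifs <;> omega
  have : ∀ i : Fin (s + 1), k i ≤ j + (s - i) := by
    intro i
    refine Fin.reverseInduction ?_ (fun i ih => ?_) i
    · simpa using hlast
    · have := hstep i
      have h2 := i.isLt
      simp only [Fin.val_succ, Fin.val_castSucc] at ih ⊢
      omega
  exact (this i).trans (by omega)

theorem finite_coeff_XTerm_ne_zero (s a : ℕ) (ha : a < s + 1) (j : ℕ) :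
    {k : Fin (s + 1) → ℕ |
      PowerSeries.coeff j (XTerm (s + 1) a (expSeries (-1)) k) ≠ 0}.Finite := by
  refine (Fintype.piFinset fun _ : Fin (s + 1) => range (j + s + 1)).finite_toSet.subset ?_
  intro k hk
  rw [mem_coe, Fintype.mem_piFinset]
  intro i
  exact mem_range.2 (Nat.lt_succ_of_le (coeff_XTerm_ne_zero_bound s a ha j k hk i))

theorem coeff_XSeries (b d j : ℕ) : PowerSeries.coeff j (XSeries (b + 1 + d) b) =
    PowerSeries.coeff j (truncSum (b + 1 + d) (b + 1) (expMul (-1 : ℂ)) 1 (j + 2)) := by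
  obtain ⟨s, hs⟩ : ∃ s, s = b + d := ⟨_, rfl⟩
  have hm : b + 1 + d = s + 1 := by omega
  -- The side `j + s + 3` contains the support and satisfies `n + s + 1 < j + s + 3` for all `n < j
  -- + 2`, as the identification with `innerSum` requires.
  have hB : j + 2 ≤ j + s + 3 := by omega
  rw [hm, XSeries, PowerSeries.coeff_mk, finsum_eq_sum_of_support_subset (s :=
    Fintype.piFinset fun _ : Fin (s + 1) => range (j + s + 3))]
  · rw [← map_sum, sum_congr rfl fun k _ => XTerm_eq_prod s b (by omega) _ k,
      sum_piFinset_chain (linkWeight b (expSeries (-1))) (j + s + 3) s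
        (fun n => qPoch (expSeries (-1)) (expSeries (-1)) n),
      truncSum, map_sum, map_sum, ← sum_subset (range_mono hB), expSeries_eq]
    · refine sum_congr rfl fun n hn => ?_
      have := mem_range.1 hn
      rw [one_mul, one_pow, mul_one, hs, chainSum_eq_innerSum b d _ _ _ (by omega),
        show b + d + 1 = b + 1 + d by ring]
    · intro n _ hn
      simp only [mem_range] at hn
      rw [expSeries_eq]
      exact PowerSeries.X_pow_dvd_iff.1 ((X_pow_dvd_qPoch (constantCoeff_expMul _)
        (constantCoeff_expMul _) _).mul_right _) j (by omega)
  · intro k hk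
    rw [mem_coe, Fintype.mem_piFinset]
    intro i
    have := coeff_XTerm_ne_zero_bound s b (by omega) j k hk i
    exact mem_range.2 (by omega)

theorem XSeries_eq (m a : ℕ) (ha : a < m) : XSeries m a =
    expSeries ((2 * m - 2 * a - 1) ^ 2 / (8 * (2 * m + 1))) *
      PowerSeries.mk (fun n : ℕ =>
        TNumber m a n / (n.factorial : ℂ) * (1 / (8 * (2 * m + 1))) ^ n) := by
  obtain ⟨d, rfl⟩ : ∃ d, m = a + 1 + d := ⟨m - a - 1, by omega⟩
  ext j
  rw [coeff_XSeries, coeff_truncSum_one a d j (j + 2) (by omega)]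

end MultiSum

/-! ### Euler transform of alternating series -/

section EulerTransform

open Finset

/-- Each difference costs one derivative and gains a factor `h` by the mean value inequality.
Quantifying over the whole family of derivatives lets the induction pass to the differenced family.
-/
theorem norm_iterate_fwdDiff_le {E : Type*} [NormedAddCommGroup E] [NormedSpace ℝ E]
    (ψ : ℕ → ℝ → E) (hψ : ∀ k y, HasDerivAt (ψ k) (ψ (k + 1) y) y) {h : ℝ} (hh : 0 ≤ h) {x B : ℝ}
    (K : ℕ) (hB : ∀ y, x ≤ y → ‖ψ K y‖ ≤ B) : ‖(fwdDiff h)^[K] (ψ 0) x‖ ≤ h ^ K * B := by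
  induction K generalizing ψ B with
  | zero => simpa using hB x le_rfl
  | succ K ih =>
    rw [Function.iterate_succ_apply, pow_succ, mul_assoc]
    refine ih (fun k => fwdDiff h (ψ k)) (fun k y => ?_) fun y hy => ?_
    · exact ((hψ k (y + h)).comp_add_const y h).sub (hψ k y)
    · rw [fwdDiff, mul_comm]
      have := Convex.norm_image_sub_le_of_norm_hasDerivWithin_le (f := ψ K) (f' := ψ (K + 1))
        (s := Set.Ici x) (x := y) (y := y + h) (C := B) (fun z _ => (hψ K z).hasDerivWithinAt)
        (fun z hz => hB z hz) (convex_Ici x) hy (by simp only [Set.mem_Ici]; linarith)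
      rwa [add_sub_cancel_left, Real.norm_of_nonneg hh] at this

/-- The polynomial factors of the derivatives of `y ↦ y * exp (-y ^ 2)`. -/
noncomputable def gaussDerivPoly : ℕ → Polynomial ℂ
  | 0 => Polynomial.X
  | k + 1 => Polynomial.derivative (gaussDerivPoly k) - 2 * Polynomial.X * gaussDerivPoly k

/-- The derivatives of `y ↦ y * exp (-y ^ 2)`. -/
noncomputable def gaussDeriv (k : ℕ) (y : ℝ) : ℂ :=
  (gaussDerivPoly k).eval (y : ℂ) * Complex.exp (-(y : ℂ) ^ 2)

theorem hasDerivAt_gaussDeriv (k : ℕ) (y : ℝ) :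
    HasDerivAt (gaussDeriv k) (gaussDeriv (k + 1) y) y := by
  have h : HasDerivAt (fun z : ℂ => (gaussDerivPoly k).eval z * Complex.exp (-z ^ 2))
      (gaussDeriv (k + 1) y) (y : ℂ) := by
    have := ((gaussDerivPoly k).hasDerivAt (y : ℂ)).mul ((hasDerivAt_pow 2 (y : ℂ)).neg.cexp)
    convert! this using 1
    rw [gaussDeriv, gaussDerivPoly]
    simp
    ring
  exact h.comp_ofReal

theorem exists_norm_eval_mul_exp_le (p : Polynomial ℂ) :
    ∃ C : ℝ, 0 ≤ C ∧ ∀ y : ℝ, 0 ≤ y → ‖p.eval (y : ℂ)‖ * Real.exp (-y ^ 2) ≤ C := by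
  induction p using Polynomial.induction_on' with
  | add p q hp hq =>
    obtain ⟨C, hC, h⟩ := hp
    obtain ⟨D, hD, h'⟩ := hq
    refine ⟨C + D, add_nonneg hC hD, fun y hy => ?_⟩
    rw [Polynomial.eval_add]
    calc _ ≤ (‖p.eval (y : ℂ)‖ + ‖q.eval (y : ℂ)‖) * Real.exp (-y ^ 2) := by
          gcongr; exact norm_add_le _ _
      _ ≤ C + D := by rw [add_mul]; exact add_le_add (h y hy) (h' y hy)
  | monomial n c =>
    refine ⟨‖c‖ * (n.factorial * Real.exp 1), by positivity, fun y hy => ?_⟩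
    rw [Polynomial.eval_monomial, norm_mul, norm_pow, Complex.norm_real, Real.norm_of_nonneg hy,
      mul_assoc]
    refine mul_le_mul_of_nonneg_left ?_ (norm_nonneg c)
    have h1 := Real.pow_div_factorial_le_exp y hy n
    rw [div_le_iff₀ (by positivity)] at h1
    calc y ^ n * Real.exp (-y ^ 2) ≤ Real.exp y * n.factorial * Real.exp (-y ^ 2) := by gcongr
      _ = n.factorial * Real.exp (y + -y ^ 2) := by rw [Real.exp_add]; ring
      _ ≤ _ := by gcongr; nlinarith [sq_nonneg (y - 1)]

theorem exists_norm_gaussDeriv_le (k : ℕ) :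
    ∃ C : ℝ, 0 ≤ C ∧ ∀ y : ℝ, 0 ≤ y → ‖gaussDeriv k y‖ ≤ C / (1 + y ^ 2) := by
  obtain ⟨C, hC, h⟩ := exists_norm_eval_mul_exp_le (gaussDerivPoly k * (1 + Polynomial.X ^ 2))
  refine ⟨C, hC, fun y hy => ?_⟩
  rw [le_div_iff₀ (by positivity)]
  refine le_trans (le_of_eq ?_) (h y hy)
  rw [gaussDeriv, norm_mul, Complex.norm_exp, Polynomial.eval_mul, norm_mul]
  have h1 : ‖Polynomial.eval (y : ℂ) (1 + Polynomial.X ^ 2)‖ = 1 + y ^ 2 := by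
    have : Polynomial.eval (y : ℂ) (1 + Polynomial.X ^ 2) = ((1 + y ^ 2 : ℝ) : ℂ) := by simp
    rw [this, Complex.norm_real, Real.norm_of_nonneg (by positivity)]
  have h2 : (-(y : ℂ) ^ 2).re = -y ^ 2 := by rw [← Complex.ofReal_pow, ← Complex.ofReal_neg]; exact Complex.ofReal_re _
  rw [h1, h2]
  ring

theorem summable_iterate_fwdDiff {E : Type*} [NormedAddCommGroup E] {g : ℕ → E}
    (hg : Summable fun j => ‖g j‖) (k : ℕ) : Summable fun j => ‖(fwdDiff 1)^[k] g j‖ := by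
  induction k generalizing g with
  | zero => exact hg
  | succ k ih =>
    refine ih (Summable.of_nonneg_of_le (fun _ => norm_nonneg _) (fun j => norm_sub_le _ _)
      (((summable_nat_add_iff 1).2 hg).add hg))

theorem tsum_alternating_eq (g : ℕ → ℂ) (hg : Summable fun j => ‖g j‖) :
    ∑' j, (-1) ^ j * g j = 1 / 2 * g 0 - 1 / 2 * ∑' j, (-1) ^ j * fwdDiff 1 g j := by
  have hs : ∀ u : ℕ → ℂ, (Summable fun j => ‖u j‖) → Summable fun j => (-1) ^ j * u j :=
    fun u hu => Summable.of_norm (by simpa using hu)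
  have h1 := (summable_nat_add_iff 1).2 hg
  have h2 := (hs g hg).tsum_eq_zero_add
  have h3 : ∑' j, (-1) ^ (j + 1) * g (j + 1) = -∑' j, (-1) ^ j * g (j + 1) := by
    rw [← tsum_neg]
    exact tsum_congr fun j => by ring
  have h4 : ∑' j, (-1) ^ j * fwdDiff 1 g j =
      ∑' j, (-1) ^ j * g (j + 1) - ∑' j, (-1) ^ j * g j := by
    rw [← (hs _ h1).tsum_sub (hs _ hg)]
    exact tsum_congr fun j => by rw [fwdDiff]; ring
  rw [h3] at h2
  rw [h4]
  linear_combination (1 / 2) * h2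

/-- The truncated Euler transform of the alternating series `∑ (-1)^j g(j)`. -/
noncomputable def eulerSum (K : ℕ) (g : ℕ → ℂ) : ℂ :=
  ∑ k ∈ range K, (-1) ^ k * (1 / 2) ^ (k + 1) * (fwdDiff 1)^[k] g 0

theorem tsum_alternating_eq_eulerSum (g : ℕ → ℂ) (hg : Summable fun j => ‖g j‖) (K : ℕ) :
    ∑' j, (-1) ^ j * g j =
      eulerSum K g + (-(1 / 2)) ^ K * ∑' j, (-1) ^ j * (fwdDiff 1)^[K] g j := by
  induction K with
  | zero => simp [eulerSum]
  | succ K ih =>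
    rw [ih, eulerSum, eulerSum, sum_range_succ,
      tsum_alternating_eq _ (summable_iterate_fwdDiff hg K), Function.iterate_succ_apply']
    rw [neg_pow, neg_pow (1 / 2 : ℂ)]
    ring

/-- The summand is `(Δ + 2) G`, so the truncated transform telescopes to `G 0` plus a multiple of
`Δ^K G 0`. -/
theorem eulerSum_add_shift (K : ℕ) (G : ℕ → ℂ) (hG : (fwdDiff 1)^[K] G 0 = 0) :
    eulerSum K (fun j => G (j + 1) + G j) = G 0 := by
  have h : (fun j => G (j + 1) + G j) = fwdDiff 1 G + (2 : ℂ) • G := by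
    ext j; simp [fwdDiff]; ring
  have e : ∀ k, (-1) ^ k * (1 / 2) ^ (k + 1) * (fwdDiff 1)^[k] (fun j => G (j + 1) + G j) 0 =
      (-(1 / 2)) ^ k * (fwdDiff 1)^[k] G 0 -
        (-(1 / 2)) ^ (k + 1) * (fwdDiff 1)^[k + 1] G 0 := by
    intro k
    rw [h, fwdDiff_iter_add, fwdDiff_iter_const_smul, ← Function.iterate_succ_apply,
      Pi.add_apply, Pi.smul_apply, Nat.succ_eq_add_one,
      smul_eq_mul, neg_pow (1 / 2 : ℂ) k, neg_pow (1 / 2 : ℂ) (k + 1)]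
    ring
  rw [eulerSum, sum_congr rfl fun k _ => e k,
    sum_range_sub' (fun k => (-(1 / 2)) ^ k * (fwdDiff 1)^[k] G 0), hG]
  simp

theorem iterate_fwdDiff_taylor_eq_zero (L : Polynomial ℂ →ₗ[ℂ] ℂ) (r : ℂ) (K : ℕ)
    (p : Polynomial ℂ) (hp : p.degree < K) (j : ℕ) :
    (fwdDiff 1)^[K] (fun j : ℕ => L (Polynomial.taylor (j * r) p)) j = 0 := by
  induction K generalizing p with
  | zero =>
    have : p = 0 := by
      rw [← Polynomial.degree_eq_bot]
      exact Nat.WithBot.lt_zero_iff.1 (by simpa using hp)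
    simp [this]
  | succ K ih =>
    have h : fwdDiff 1 (fun j : ℕ => L (Polynomial.taylor (j * r) p)) =
        fun j : ℕ => L (Polynomial.taylor (j * r) (Polynomial.taylor r p - p)) := by
      ext j
      rw [fwdDiff, map_sub, map_sub, Polynomial.taylor_taylor]
      congr 3
      push_cast
      ring_nf
    rw [Function.iterate_succ_apply, h]
    refine ih _ ?_
    rcases eq_or_ne p 0 with rfl | h0
    · simp
    · have h1 := Polynomial.degree_sub_lt_left (Polynomial.degree_taylor p r)
        (by rwa [Ne, Polynomial.taylor_eq_zero]) (Polynomial.leadingCoeff_taylor ..)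
      rw [Polynomial.degree_taylor] at h1
      rw [Polynomial.degree_eq_natDegree h0] at h1 hp
      exact h1.trans_le (by exact_mod_cast Nat.lt_succ_iff.1 (by exact_mod_cast hp))

/-- By `lFunctional_shift` the sequence is `G(j+1) + G(j)`, where `G(j)` is the functional on `p`
translated by `j(4m+2)`. Each difference of `G` lowers the degree, so the `K`-th one is zero. -/
theorem eulerSum_polynomial (m a : ℕ) (ha : a < m) (K : ℕ) (p : Polynomial ℂ)
    (hp : p.degree < K) :
    eulerSum K (fun j : ℕ => p.eval (2 * m - 2 * a - 1 + j * (4 * m + 2) : ℂ) -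
      p.eval (2 * m + 2 * a + 3 + j * (4 * m + 2) : ℂ)) = lFunctional m a p := by
  have h := eulerSum_add_shift K
    (fun j : ℕ => lFunctional m a (Polynomial.taylor (j * (4 * m + 2) : ℂ) p))
    (iterate_fwdDiff_taylor_eq_zero _ _ K p hp 0)
  simp only [Nat.cast_zero, zero_mul, Polynomial.taylor_zero] at h
  rw [← h]
  congr 1
  ext j
  have := lFunctional_shift m a ha (Polynomial.taylor (j * (4 * m + 2) : ℂ) p)
  rw [← Polynomial.taylor_apply, Polynomial.taylor_taylor, Polynomial.taylor_eval,
    Polynomial.taylor_eval] at this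
  rw [← this]
  congr 4
  push_cast
  ring

end EulerTransform

/-! ### Asymptotics of `∑ χ(n) n e^{-s n²}` -/

section AsymptoticExpansion

open Finset Filter Topology

theorem chi_sum_range_mul (m a : ℕ) (ha : a < m) (f : ℕ → ℂ) (J : ℕ) :
    ∑ n ∈ range (J * (4 * m + 2)), (chi m a (n : ZMod (8 * m + 4)) : ℂ) * f n =
      ∑ j ∈ range J, (-1) ^ j * (f (2 * m - 2 * a - 1 + j * (4 * m + 2)) -
        f (2 * m + 2 * a + 3 + j * (4 * m + 2))) := by
  have hchi : ∀ J r : ℕ, chi m a ((r + J * (4 * m + 2) : ℕ) : ZMod (8 * m + 4)) =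
      (-1) ^ J * chi m a (r : ZMod (8 * m + 4)) := by
    intro J r
    induction J with
    | zero => simp
    | succ J ih =>
      have h := chi_add_half m a ha (r + J * (4 * m + 2))
      rw [ih, show r + J * (4 * m + 2) + (4 * m + 2) = r + (J + 1) * (4 * m + 2) by ring] at h
      rw [h]; ring
  induction J with
  | zero => simp
  | succ J ih =>
    rw [add_mul, one_mul, sum_range_add, ih, sum_range_succ _ J]
    congr 1
    have := sum_range_half_chi m a ha fun r => f (r + J * (4 * m + 2))
    rw [← this, mul_sum]
    refine sum_congr rfl fun r _ => ?_
    rw [add_comm (J * (4 * m + 2)) r, hchi, zsmul_eq_mul]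
    push_cast
    ring

theorem tsum_chi_mul (m a : ℕ) (ha : a < m) (f : ℕ → ℂ) (hf : Summable fun n => ‖f n‖) :
    ∑' n : ℕ, (chi m a (n : ZMod (8 * m + 4)) : ℂ) * f n =
      ∑' j : ℕ, (-1) ^ j * (f (2 * m - 2 * a - 1 + j * (4 * m + 2)) -
        f (2 * m + 2 * a + 3 + j * (4 * m + 2))) ∧
    Summable (fun j : ℕ => ‖f (2 * m - 2 * a - 1 + j * (4 * m + 2)) -
        f (2 * m + 2 * a + 3 + j * (4 * m + 2))‖) := by
  have hinj : ∀ c, Function.Injective fun j : ℕ => c + j * (4 * m + 2) := fun c i j h => by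
    simpa using h
  have h1 := (hf.comp_injective (hinj (2 * m - 2 * a - 1))).add
    (hf.comp_injective (hinj (2 * m + 2 * a + 3)))
  have h2 : Summable (fun j : ℕ => ‖f (2 * m - 2 * a - 1 + j * (4 * m + 2)) -
        f (2 * m + 2 * a + 3 + j * (4 * m + 2))‖) :=
    Summable.of_nonneg_of_le (fun _ => norm_nonneg _) (fun j => norm_sub_le _ _) h1
  refine ⟨?_, h2⟩
  have h3 : Summable fun j : ℕ => (-1) ^ j * (f (2 * m - 2 * a - 1 + j * (4 * m + 2)) -
        f (2 * m + 2 * a + 3 + j * (4 * m + 2))) := Summable.of_norm (by simpa using h2)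
  have h4 : Summable fun n : ℕ => (chi m a (n : ZMod (8 * m + 4)) : ℂ) * f n := by
    refine Summable.of_norm_bounded hf fun n => ?_
    rw [norm_mul]
    refine mul_le_of_le_one_left (norm_nonneg _) ?_
    rw [chi]
    split_ifs <;> simp
  -- Comparing partial sums along multiples of `4m + 2` avoids any rearrangement.
  have t1 := h4.hasSum.tendsto_sum_nat.comp (tendsto_id.atTop_mul_const' (r := 4 * m + 2) (by omega))
  refine tendsto_nhds_unique t1 (h3.hasSum.tendsto_sum_nat.congr fun J => ?_)
  exact (chi_sum_range_mul m a ha f J).symm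

theorem iterate_fwdDiff_comp_affine (ψ : ℝ → ℂ) (x h : ℝ) (K j : ℕ) :
    (fwdDiff 1)^[K] (fun j : ℕ => ψ (x + h * j)) j = (fwdDiff h)^[K] ψ (x + h * j) := by
  induction K generalizing ψ with
  | zero => rfl
  | succ K ih =>
    have e : fwdDiff 1 (fun j : ℕ => ψ (x + h * j)) = fun j : ℕ => fwdDiff h ψ (x + h * j) := by
      ext j
      simp only [fwdDiff]
      congr 2
      push_cast
      ring
    rw [Function.iterate_succ_apply, Function.iterate_succ_apply, ← ih, e]

/-- The function `n ↦ n * exp (-s n ^ 2)`. -/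
noncomputable def gaussTerm (s : ℝ) (n : ℕ) : ℂ := n * Complex.exp (-(s * (n : ℂ) ^ 2))

theorem norm_gaussTerm (s : ℝ) (n : ℕ) : ‖gaussTerm s n‖ = n * Real.exp (-(s * (n : ℝ) ^ 2)) := by
  rw [gaussTerm, norm_mul, Complex.norm_natCast, Complex.norm_exp]
  congr 2
  rw [← Complex.ofReal_natCast, ← Complex.ofReal_pow, ← Complex.ofReal_mul, ← Complex.ofReal_neg]
  exact Complex.ofReal_re _

theorem summable_norm_gaussTerm {s : ℝ} (hs : 0 < s) : Summable fun n => ‖gaussTerm s n‖ := by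
  refine Summable.of_nonneg_of_le (fun _ => norm_nonneg _) (fun n => ?_)
    (Real.summable_pow_mul_exp_neg_nat_mul 1 hs)
  rw [norm_gaussTerm, pow_one]
  gcongr
  rcases n with _ | n
  · simp
  · have : (1 : ℝ) ≤ ((n + 1 : ℕ) : ℝ) := by exact_mod_cast Nat.succ_le_succ n.zero_le
    nlinarith [mul_le_mul_of_nonneg_left this (mul_nonneg hs.le (zero_le_one.trans this))]

theorem gaussTerm_eq_gaussDeriv {s : ℝ} (hs : 0 < s) (n : ℕ) :
    gaussTerm s n = ((√s)⁻¹ : ℝ) * gaussDeriv 0 (√s * n) := by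
  have h : (√s : ℂ) ≠ 0 := by exact_mod_cast (Real.sqrt_pos.2 hs).ne'
  have h2 : (√s : ℂ) ^ 2 = s := by exact_mod_cast Real.sq_sqrt hs.le
  rw [gaussTerm, gaussDeriv, gaussDerivPoly, Polynomial.eval_X]
  push_cast
  rw [mul_pow, h2]
  field_simp

/-- In the variable `y = √s n` the step is `√s P`, giving `(√s P)^K`, while `n = y / √s` costs
`(√s)⁻¹`. For `s ≤ 1` the decay `1 / (1 + y²)` is at most `1 / (s (1 + j²))`, summable in `j`. -/
theorem norm_iterate_fwdDiff_gaussTerm_le (K : ℕ) : ∃ C : ℝ, 0 ≤ C ∧ ∀ s : ℝ, 0 < s → s ≤ 1 →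
    ∀ c P : ℕ, 1 ≤ P → ∀ j : ℕ, ‖(fwdDiff 1)^[K] (fun j : ℕ => gaussTerm s (c + j * P)) j‖ ≤
      (√s)⁻¹ * ((√s * P) ^ K * (C / (s * (1 + (j : ℝ) ^ 2)))) := by
  obtain ⟨C, hC, h⟩ := exists_norm_gaussDeriv_le K
  refine ⟨C, hC, fun s hs hs1 c P hP j => ?_⟩
  have hσ := Real.sqrt_pos.2 hs
  have e : (fun j : ℕ => gaussTerm s (c + j * P)) = (((√s)⁻¹ : ℝ) : ℂ) •
      fun j : ℕ => gaussDeriv 0 (√s * c + √s * P * j) := by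
    ext j
    rw [gaussTerm_eq_gaussDeriv hs, Pi.smul_apply, smul_eq_mul]
    congr 2
    push_cast
    ring
  rw [e, fwdDiff_iter_const_smul, Pi.smul_apply, iterate_fwdDiff_comp_affine, norm_smul,
    Complex.norm_real, Real.norm_of_nonneg (inv_nonneg.2 hσ.le)]
  refine mul_le_mul_of_nonneg_left ?_ (inv_nonneg.2 hσ.le)
  refine norm_iterate_fwdDiff_le gaussDeriv hasDerivAt_gaussDeriv (by positivity) K fun y hy => ?_
  have hP' : (1 : ℝ) ≤ P := by exact_mod_cast hP
  have hy1 : √s * j ≤ y := by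
    refine le_trans ?_ hy
    have h1 : √s * j ≤ √s * P * j := by
      rw [mul_right_comm]; exact le_mul_of_one_le_right (by positivity) hP'
    have h2 : 0 ≤ √s * c := by positivity
    linarith
  have hy0 : 0 ≤ y := le_trans (by positivity) hy1
  refine (h y hy0).trans (div_le_div_of_nonneg_left hC (by positivity) ?_)
  have hy2 : s * (j : ℝ) ^ 2 ≤ y ^ 2 := by
    calc s * (j : ℝ) ^ 2 = (√s * j) ^ 2 := by rw [mul_pow, Real.sq_sqrt hs.le]
      _ ≤ y ^ 2 := by gcongr
  nlinarith

theorem summable_one_div_one_add_sq : Summable fun j : ℕ => 1 / (1 + (j : ℝ) ^ 2) := by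
  refine (summable_nat_add_iff 1).1 (Summable.of_nonneg_of_le (fun j => by positivity) (fun j => ?_)
    ((summable_nat_add_iff 1).2 (Real.summable_one_div_nat_pow.2 one_lt_two)))
  gcongr
  linarith

theorem isBigO_eulerSum {l : Filter ℝ} {φ : ℝ → ℝ} (r : ℝ → ℕ → ℂ)
    (hr : ∀ j, (fun s => r s j) =O[l] φ) (K : ℕ) : (fun s => eulerSum K (r s)) =O[l] φ := by
  have h : ∀ k j, (fun s => (fwdDiff 1)^[k] (r s) j) =O[l] φ := by
    intro k
    induction k with
    | zero => exact hr
    | succ k ih =>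
      intro j
      simp only [Function.iterate_succ_apply', fwdDiff]
      exact (ih (j + 1)).sub (ih j)
  exact Asymptotics.IsBigO.fun_sum fun k _ => (h k 0).const_mul_left _

theorem eulerSum_sub (K : ℕ) (g g' : ℕ → ℂ) :
    eulerSum K (fun j => g j - g' j) = eulerSum K g - eulerSum K g' := by
  have h : (fun j => g j - g' j) = g + (-1 : ℂ) • g' := by ext j; simp; ring
  rw [eulerSum, eulerSum, eulerSum, ← sum_sub_distrib]
  refine sum_congr rfl fun k _ => ?_
  rw [h, fwdDiff_iter_add, fwdDiff_iter_const_smul]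
  simp
  ring

/-- The Taylor polynomial in `s` of `n * exp (-s n ^ 2)`, as a polynomial in `n`. -/
noncomputable def gaussTaylor (N : ℕ) (s : ℝ) : Polynomial ℂ :=
  ∑ i ∈ range N, Polynomial.C ((-s : ℂ) ^ i / i.factorial) * Polynomial.X ^ (2 * i + 1)

theorem isBigO_gaussTerm_sub (N n : ℕ) :
    (fun s : ℝ => gaussTerm s n - (gaussTaylor N s).eval (n : ℂ)) =O[𝓝[>] 0] fun s => s ^ N := by
  have ht : Tendsto (fun s : ℝ => -((s : ℂ) * (n : ℂ) ^ 2)) (𝓝[>] 0) (𝓝 0) := by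
    have : Continuous fun s : ℝ => -((s : ℂ) * (n : ℂ) ^ 2) := by fun_prop
    simpa using (this.tendsto 0).mono_left nhdsWithin_le_nhds
  have h := ((Complex.exp_sub_sum_range_isBigO_pow N).comp_tendsto ht).const_mul_left (n : ℂ)
  have e : (fun s : ℝ => gaussTerm s n - (gaussTaylor N s).eval (n : ℂ)) = fun s : ℝ => (n : ℂ) *
      ((fun x => Complex.exp x - ∑ i ∈ range N, x ^ i / i.factorial) ∘
        fun s : ℝ => -((s : ℂ) * (n : ℂ) ^ 2)) s := by
    ext s
    rw [gaussTerm, gaussTaylor, Polynomial.eval_finsetSum, Function.comp_apply, mul_sub]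
    congr 1
    rw [mul_sum]
    refine sum_congr rfl fun i _ => ?_
    simp only [Polynomial.eval_mul, Polynomial.eval_C, Polynomial.eval_pow, Polynomial.eval_X]
    rw [← neg_mul, mul_pow, ← pow_mul]
    ring
  rw [e]
  refine h.trans ?_
  refine Asymptotics.IsBigO.of_bound (((n : ℝ) ^ 2) ^ N) (Eventually.of_forall fun s => le_of_eq ?_)
  simp only [Function.comp_apply, norm_pow, norm_neg, norm_mul, Complex.norm_real,
    Complex.norm_natCast]
  rw [mul_pow, mul_comm]

theorem lFunctional_gaussTaylor (m a N : ℕ) (s : ℝ) : lFunctional m a (gaussTaylor N s) =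
    ∑ i ∈ range N, (-s : ℂ) ^ i / i.factorial * lValue m a (2 * i + 1) := by
  rw [gaussTaylor, map_sum]
  exact sum_congr rfl fun i _ => lFunctional_C_mul_X_pow ..

theorem degree_gaussTaylor_lt (N : ℕ) (s : ℝ) :
    (gaussTaylor N s).degree < ((2 * N + 3 : ℕ) : WithBot ℕ) := by
  rw [gaussTaylor]
  refine (Polynomial.degree_sum_le _ _).trans_lt ?_
  refine (Finset.sup_lt_iff (WithBot.bot_lt_coe _)).2 fun i hi => ?_
  refine (Polynomial.degree_C_mul_X_pow_le _ _).trans_lt ?_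
  have := mem_range.1 hi
  exact_mod_cast (show 2 * i + 1 < 2 * N + 3 by omega)

theorem isBigO_tsum_chi_gaussTerm (m a : ℕ) (ha : a < m) (N : ℕ) :
    (fun s : ℝ => ∑' n : ℕ, (chi m a (n : ZMod (8 * m + 4)) : ℂ) * gaussTerm s n -
      ∑ i ∈ range N, (-s : ℂ) ^ i / i.factorial * lValue m a (2 * i + 1))
      =O[𝓝[>] 0] fun s => s ^ N := by
  -- The remainder is of order `(√s)^{K-3}`, one power lost to the rescaling and two to the decay
  -- bound; `K = 2N + 3` makes this `s^N` and also exceeds the degree of the Taylor polynomial.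
  set K := 2 * N + 3 with hK
  set c₁ := 2 * m - 2 * a - 1 with hc₁
  set c₂ := 2 * m + 2 * a + 3 with hc₂
  set P := 4 * m + 2 with hP
  have hc₁' : (c₁ : ℂ) = 2 * m - 2 * a - 1 := by
    rw [hc₁, Nat.cast_sub (by omega), Nat.cast_sub (by omega)]; push_cast; rfl
  have hc₂' : (c₂ : ℂ) = 2 * m + 2 * a + 3 := by rw [hc₂]; push_cast; rfl
  have hP' : (P : ℂ) = 4 * m + 2 := by rw [hP]; push_cast; rfl
  obtain ⟨C, hC, hb⟩ := norm_iterate_fwdDiff_gaussTerm_le K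
  let g : ℝ → ℕ → ℂ := fun s j => gaussTerm s (c₁ + j * P) - gaussTerm s (c₂ + j * P)
  have hmain : (fun s : ℝ => eulerSum K (g s) -
      ∑ i ∈ range N, (-s : ℂ) ^ i / i.factorial * lValue m a (2 * i + 1))
      =O[𝓝[>] 0] fun s => s ^ N := by
    -- The finite part involves boundedly many values of `g s`, so pointwise Taylor errors suffice
    -- without uniformity in `j`.
    have h := isBigO_eulerSum (l := 𝓝[>] 0) (φ := fun s => s ^ N) (fun s j => g s j -
      ((gaussTaylor N s).eval (2 * m - 2 * a - 1 + j * (4 * m + 2) : ℂ) -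
      (gaussTaylor N s).eval (2 * m + 2 * a + 3 + j * (4 * m + 2) : ℂ))) (fun j => ?_) K
    · refine h.congr_left fun s => ?_
      rw [eulerSum_sub, eulerSum_polynomial m a ha K _ (degree_gaussTaylor_lt N s),
        lFunctional_gaussTaylor]
    · refine ((isBigO_gaussTerm_sub N (c₁ + j * P)).sub
        (isBigO_gaussTerm_sub N (c₂ + j * P))).congr_left fun s => ?_
      push_cast
      rw [hc₁', hc₂', hP']
      ring
  have hrem : (fun s : ℝ => (-(1 / 2) : ℂ) ^ K * ∑' j, (-1) ^ j * (fwdDiff 1)^[K] (g s) j)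
      =O[𝓝[>] 0] fun s => s ^ N := by
    refine Asymptotics.IsBigO.const_mul_left ?_ _
    set S := ∑' j : ℕ, 1 / (1 + (j : ℝ) ^ 2) with hS
    refine Asymptotics.IsBigO.of_bound (2 * (P : ℝ) ^ K * C * S) ?_
    filter_upwards [Ioc_mem_nhdsGT (zero_lt_one' ℝ)] with s hs
    have hσ := Real.sqrt_pos.2 hs.1
    have hterm : ∀ j, ‖(-1) ^ j * (fwdDiff 1)^[K] (g s) j‖ ≤
        2 * (P : ℝ) ^ K * C * s ^ N * (1 / (1 + (j : ℝ) ^ 2)) := by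
      intro j
      have e : g s = (fun j => gaussTerm s (c₁ + j * P)) +
          (-1 : ℂ) • fun j => gaussTerm s (c₂ + j * P) := by
        ext j; simp [g]; ring
      rw [norm_mul, norm_pow, norm_neg, norm_one, one_pow, one_mul, e, fwdDiff_iter_add,
        fwdDiff_iter_const_smul, Pi.add_apply, Pi.smul_apply]
      refine (norm_add_le _ _).trans ?_
      rw [norm_smul, norm_neg, norm_one, one_mul]
      refine (add_le_add (hb s hs.1 hs.2 c₁ P (by omega) j)
        (hb s hs.1 hs.2 c₂ P (by omega) j)).trans (le_of_eq ?_)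
      have e2 : s = √s ^ 2 := (Real.sq_sqrt hs.1.le).symm
      rw [hK]
      generalize √s = σ at *
      subst e2
      field_simp
      ring
    have := tsum_of_norm_bounded (summable_one_div_one_add_sq.hasSum.mul_left _) hterm
    refine this.trans (le_of_eq ?_)
    rw [norm_pow, Real.norm_of_nonneg hs.1.le]
    ring
  refine (hmain.add hrem).congr' ?_ (EventuallyEq.refl _ _)
  filter_upwards [self_mem_nhdsWithin] with s hs
  obtain ⟨h1, h2⟩ := tsum_chi_mul m a ha (gaussTerm s) (summable_norm_gaussTerm hs)
  rw [h1, tsum_alternating_eq_eulerSum _ h2 K]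
  ring

end AsymptoticExpansion

/-! ### Products of asymptotic expansions and the half-derivative -/

section AsymptoticProduct

open Finset Filter Topology

/-- The function `f` has the asymptotic expansion `S` at `0` from the right. -/
def HasAsymptoticExpansion (f : ℝ → ℂ) (S : ℂ⟦X⟧) : Prop :=
  ∀ N : ℕ, (fun t : ℝ => f t - ∑ j ∈ range N, PowerSeries.coeff j S * (t : ℂ) ^ j)
    =O[𝓝[>] 0] fun t : ℝ => t ^ N

theorem sum_range_coeff_eq_eval_trunc (S : ℂ⟦X⟧) (N : ℕ) (z : ℂ) :
    ∑ j ∈ range N, PowerSeries.coeff j S * z ^ j = (PowerSeries.trunc N S).eval z := by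
  rw [Polynomial.eval, PowerSeries.eval₂_trunc_eq_sum_range]
  simp

theorem isBigO_one_eval (p : Polynomial ℂ) :
    (fun t : ℝ => p.eval (t : ℂ)) =O[𝓝[>] 0] fun _ : ℝ => (1 : ℝ) := by
  have : Continuous fun t : ℝ => p.eval (t : ℂ) := p.continuous.comp Complex.continuous_ofReal
  exact ((this.tendsto 0).mono_left nhdsWithin_le_nhds).isBigO_one ℝ

theorem HasAsymptoticExpansion.mul {f g : ℝ → ℂ} {S T : ℂ⟦X⟧} (hf : HasAsymptoticExpansion f S)
    (hg : HasAsymptoticExpansion g T) : HasAsymptoticExpansion (fun t => f t * g t) (S * T) := by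
  intro N
  have hf' := hf N
  have hg' := hg N
  -- The expansion of order 0 is just boundedness near 0.
  have hg0 : g =O[𝓝[>] 0] fun _ : ℝ => (1 : ℝ) := by simpa using hg 0
  simp only [sum_range_coeff_eq_eval_trunc] at hf' hg' ⊢
  have h1 := hf'.mul hg0
  have h2 := (isBigO_one_eval (PowerSeries.trunc N S)).mul hg'
  -- With `S_N`, `T_N` the truncations, the error is `(f - S_N) g + S_N (g - T_N)` plus this
  -- polynomial, which has no terms below degree `N`.
  obtain ⟨Q, hQ⟩ : Polynomial.X ^ N ∣ PowerSeries.trunc N S * PowerSeries.trunc N T -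
      PowerSeries.trunc N (S * T) := by
    rw [Polynomial.X_pow_dvd_iff]
    intro d hd
    rw [Polynomial.coeff_sub, PowerSeries.coeff_trunc, if_pos hd,
      PowerSeries.coeff_mul_eq_coeff_trunc_mul_trunc S T hd, ← Polynomial.coe_mul,
      Polynomial.coeff_coe, sub_self]
  have h3 : (fun t : ℝ => (PowerSeries.trunc N S).eval (t : ℂ) * (PowerSeries.trunc N T).eval (t : ℂ)
      - (PowerSeries.trunc N (S * T)).eval (t : ℂ)) =O[𝓝[>] 0] fun t : ℝ => t ^ N := by
    have h4 : (fun t : ℝ => (t : ℂ) ^ N) =O[𝓝[>] 0] fun t : ℝ => t ^ N :=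
      Asymptotics.IsBigO.of_bound 1 (Eventually.of_forall fun t => by simp)
    refine ((h4.mul (isBigO_one_eval Q)).congr_left fun t => ?_).trans (by simp [Asymptotics.isBigO_refl])
    rw [← Polynomial.eval_mul, ← Polynomial.eval_sub, hQ]
    simp
  simp only [mul_one, one_mul] at h1 h2
  refine ((h1.add h2).add h3).congr_left fun t => ?_
  ring

theorem hasAsymptoticExpansion_exp (κ : ℝ) :
    HasAsymptoticExpansion (fun t => (Real.exp (κ * t) : ℂ)) (expSeries κ) := by
  intro N
  have ht : Tendsto (fun t : ℝ => (κ : ℂ) * t) (𝓝[>] 0) (𝓝 0) := by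
    have : Continuous fun t : ℝ => (κ : ℂ) * t := by fun_prop
    simpa using (this.tendsto 0).mono_left nhdsWithin_le_nhds
  have h := (Complex.exp_sub_sum_range_isBigO_pow N).comp_tendsto ht
  refine (h.congr_left fun t => ?_).trans ?_
  · rw [Function.comp_apply]
    push_cast
    congr 1
    refine sum_congr rfl fun i _ => ?_
    rw [expSeries_eq, coeff_expMul, mul_pow]
    simp
    ring
  · refine Asymptotics.IsBigO.of_bound (|κ| ^ N) (Eventually.of_forall fun t => le_of_eq ?_)
    simp [mul_pow]

theorem hasAsymptoticExpansion_tsum_chi (m a : ℕ) (ha : a < m) :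
    HasAsymptoticExpansion (fun t => -(1 / 2) * ∑' n : ℕ, (chi m a (n : ZMod (8 * m + 4)) : ℂ) *
      gaussTerm (t / (8 * (2 * m + 1))) n) (PowerSeries.mk (fun n : ℕ =>
        TNumber m a n / (n.factorial : ℂ) * (1 / (8 * (2 * m + 1))) ^ n)) := by
  intro N
  have ht : Tendsto (fun t : ℝ => t / (8 * (2 * m + 1))) (𝓝[>] 0) (𝓝[>] 0) := by
    refine tendsto_nhdsWithin_iff.2 ⟨?_, ?_⟩
    · have : Continuous fun t : ℝ => t / (8 * (2 * m + 1)) := by fun_prop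
      simpa using (this.tendsto 0).mono_left nhdsWithin_le_nhds
    · filter_upwards [self_mem_nhdsWithin] with t ht
      exact div_pos (Set.mem_Ioi.1 ht) (by positivity : (0 : ℝ) < 8 * (2 * m + 1))
  have h := ((isBigO_tsum_chi_gaussTerm m a ha N).comp_tendsto ht).const_mul_left (-(1 / 2))
  refine (h.congr_left fun t => ?_).trans ?_
  · rw [Function.comp_apply, mul_sub, mul_sum]
    congr 1
    refine sum_congr rfl fun i _ => ?_
    rw [PowerSeries.coeff_mk, TNumber_eq m a ha, neg_pow]
    push_cast
    rw [div_pow, one_div_pow, pow_succ (-1 : ℂ)]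
    ring
  · refine Asymptotics.IsBigO.of_bound (|(1 / (8 * (2 * m + 1)) : ℝ)| ^ N)
      (Eventually.of_forall fun t => le_of_eq ?_)
    rw [Function.comp_apply, norm_pow, norm_pow, ← mul_pow, Real.norm_eq_abs, Real.norm_eq_abs,
      ← abs_mul]
    congr 2
    ring

theorem halfTerm_exp (m a : ℕ) (t : ℝ) (n : ℕ) : (halfTerm m a (Real.exp (-t)) n : ℂ) =
    (Real.exp ((2 * m - 2 * a - 1) ^ 2 / (8 * (2 * m + 1)) * t) : ℂ) *
      ((chi m a (n : ZMod (8 * m + 4)) : ℂ) * gaussTerm (t / (8 * (2 * m + 1))) n) := by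
  have : Complex.exp (-(((t / (8 * (2 * m + 1)) : ℝ) : ℂ) * (n : ℂ) ^ 2)) =
      (Real.exp (-(t / (8 * (2 * m + 1)) * (n : ℝ) ^ 2)) : ℂ) := by push_cast; rfl
  rw [halfTerm, gaussTerm, this, ← Real.exp_mul,
    show -t * (((n : ℝ) ^ 2 - (2 * m - 2 * a - 1 : ℝ) ^ 2) / (8 * (2 * m + 1))) =
      (2 * m - 2 * a - 1) ^ 2 / (8 * (2 * m + 1)) * t +
      -(t / (8 * (2 * m + 1)) * (n : ℝ) ^ 2) by ring, Real.exp_add]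
  push_cast
  ring

theorem summable_halfTerm (m a : ℕ) (q : ℝ) (h0 : 0 < q) (h1 : q < 1) :
    Summable (halfTerm m a q) := by
  obtain ⟨t, ht, rfl⟩ : ∃ t, 0 < t ∧ q = Real.exp (-t) :=
    ⟨-Real.log q, neg_pos.2 (Real.log_neg h0 h1), by rw [neg_neg, Real.exp_log h0]⟩
  refine Summable.of_norm_bounded ((summable_norm_gaussTerm
    (s := t / (8 * (2 * m + 1))) (div_pos ht (by positivity))).mul_left
    (Real.exp ((2 * m - 2 * a - 1) ^ 2 / (8 * (2 * m + 1)) * t))) fun n => ?_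
  rw [← Complex.norm_real, halfTerm_exp, norm_mul, norm_mul, Complex.norm_real,
    Real.norm_of_nonneg (Real.exp_pos _).le]
  refine mul_le_mul_of_nonneg_left (mul_le_of_le_one_left (norm_nonneg _) ?_) (Real.exp_pos _).le
  rw [chi]
  split_ifs <;> simp

theorem halfDerivative_exp (m a : ℕ) (t : ℝ) : (halfDerivative m a (Real.exp (-t)) : ℂ) =
    (Real.exp ((2 * m - 2 * a - 1) ^ 2 / (8 * (2 * m + 1)) * t) : ℂ) *
      (-(1 / 2) * ∑' n : ℕ, (chi m a (n : ZMod (8 * m + 4)) : ℂ) *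
        gaussTerm (t / (8 * (2 * m + 1))) n) := by
  rw [halfDerivative, Complex.ofReal_mul, Complex.ofReal_tsum, tsum_congr (halfTerm_exp m a t),
    tsum_mul_left]
  push_cast
  ring

theorem hasAsymptoticExpansion_halfDerivative (m a : ℕ) (ha : a < m) :
    HasAsymptoticExpansion (fun t => (halfDerivative m a (Real.exp (-t)) : ℂ)) (XSeries m a) := by
  have h := (hasAsymptoticExpansion_exp ((2 * m - 2 * a - 1) ^ 2 / (8 * (2 * m + 1)))).mul
    (hasAsymptoticExpansion_tsum_chi m a ha)
  rw [XSeries_eq m a ha]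
  simp only [halfDerivative_exp]
  convert! h using 3
  push_cast
  rfl

end AsymptoticProduct

theorem theorem2 (m a : ℕ) (hm : 1 ≤ m) (ha : a ≤ m - 1) :
    -- the sum defining the Taylor expansion of `X_m^{(a)}(e^{-t})` is finite in each degree
    (∀ j : ℕ, {k : Fin m → ℕ |
      PowerSeries.coeff j (XTerm m a (expSeries (-1)) k) ≠ 0}.Finite) ∧
    -- the expansion, as an identity of formal power series in `t`
    XSeries m a =
      expSeries ((2 * m - 2 * a - 1) ^ 2 / (8 * (2 * m + 1))) *
        PowerSeries.mk (fun n : ℕ =>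
          TNumber m a n / (n.factorial : ℂ) * (1 / (8 * (2 * m + 1))) ^ n) ∧
    -- the expression of `T_m^{(a)}(n)` by Bernoulli polynomials
    (∀ n : ℕ, TNumber m a n =
      (-1) ^ n * 2 ^ (4 * n) * ((2 * m + 1) ^ (2 * n + 1) / (n + 1)) *
        ∑ r ∈ Finset.Icc 1 (8 * m + 4), (chi m a r : ℂ) *
          (((Polynomial.bernoulli (2 * n + 2)).eval ((r : ℚ) / (8 * m + 4)) : ℚ) : ℂ)) ∧
    -- the half-derivative series converges for `0 < q < 1`
    (∀ q : ℝ, 0 < q → q < 1 → Summable (halfTerm m a q)) ∧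
    -- its Taylor (asymptotic) expansion at `q = e^{-t}`, `t → 0+`, is that of `X_m^{(a)}`
    (∀ N : ℕ, (fun t : ℝ => (halfDerivative m a (Real.exp (-t)) : ℂ) -
        ∑ j ∈ Finset.range N, PowerSeries.coeff j (XSeries m a) * (t : ℂ) ^ j)
      =O[nhdsWithin 0 (Set.Ioi 0)] (fun t : ℝ => t ^ N)) := by
  have ha' : a < m := by omega
  obtain ⟨s, rfl⟩ : ∃ s, m = s + 1 := ⟨m - 1, by omega⟩
  exact ⟨finite_coeff_XTerm_ne_zero s a ha', XSeries_eq _ a ha', TNumber_eq_bernoulli _ a ha',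
    summable_halfTerm _ a, hasAsymptoticExpansion_halfDerivative _ a ha'⟩
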